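/- Let $\psi=\Gamma'/\Gamma$. For real $x>0$ that is not an integer, put $$\begin{aligned} R(x)={}&\frac{\pi}{3}\log x+\frac{1}{2x}-\frac{1}{4\pi x^2}+\frac{\pi\cot(\pi x)}{e^{2\pi x}-1}+\frac{\pi\log|2\sin(\pi x)|}{2\sinh^2(\pi x)}\\ &+\sum_{k=1}^\infty\frac{2k}{(e^{2\pi k}-1)(k^2-x^2)}-\frac{\pi}{2}\sum_{k=1}^\infty\frac{\log|k^4-x^4|}{\sinh^2(\pi k)}\\ &-2\pi\sum_{k=1}^\infty e^{-2\pi kx}\left(k^2\sum_{n=1}^\infty\frac{\sin(2\pi nx)}{k^2+n^2}-k^3\sum_{n=1}^\infty\frac{\cos(2\pi nx)}{n(k^2+n^2)}\right). \end{aligned}$$ Then for every real $x>0$, $$\psi(x+1)=R(x),$$ where at a positive integer $x=m$, at which some individual terms of $R$ are singular, the right-hand side is understood as the limit $\lim_{x\to m}R(x)$. For every non-integer $x>0$ all the series in $R(x)$, including the inner series over $n$ and the outer series over $k$ of the last line, converge absolutely. -/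

import Mathlib

noncomputable section

namespace RamanujanPsi

/-- `ψ = Γ'/Γ` on the real line. -/
def psi (y : ℝ) : ℝ := deriv Real.Gamma y / Real.Gamma y

/-- The part of the right-hand side that is not a series. -/
def elementaryPart (x : ℝ) : ℝ :=
  Real.pi / 3 * Real.log x + 1 / (2 * x) - 1 / (4 * Real.pi * x ^ 2)
    + Real.pi * Real.cot (Real.pi * x) / (Real.exp (2 * Real.pi * x) - 1)
    + Real.pi * Real.log |2 * Real.sin (Real.pi * x)| / (2 * Real.sinh (Real.pi * x) ^ 2)

/-- The `k`-th term, `k ≥ 1`, of the first series. -/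
def poleTerm (x : ℝ) (k : ℕ) : ℝ :=
  2 * (k : ℝ) / ((Real.exp (2 * Real.pi * k) - 1) * ((k : ℝ) ^ 2 - x ^ 2))

/-- The `k`-th term, `k ≥ 1`, of the second series. -/
def logTerm (x : ℝ) (k : ℕ) : ℝ :=
  Real.log |(k : ℝ) ^ 4 - x ^ 4| / Real.sinh (Real.pi * k) ^ 2

/-- The `n`-th term, `n ≥ 1`, of the inner sine series. -/
def sinTerm (x : ℝ) (k n : ℕ) : ℝ :=
  Real.sin (2 * Real.pi * n * x) / ((k : ℝ) ^ 2 + (n : ℝ) ^ 2)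

/-- The `n`-th term, `n ≥ 1`, of the inner cosine series. -/
def cosTerm (x : ℝ) (k n : ℕ) : ℝ :=
  Real.cos (2 * Real.pi * n * x) / ((n : ℝ) * ((k : ℝ) ^ 2 + (n : ℝ) ^ 2))

/-- The `k`-th term, `k ≥ 1`, of the double series; the inner sums run over `n ≥ 1`. -/
def doubleTerm (x : ℝ) (k : ℕ) : ℝ :=
  Real.exp (-(2 * Real.pi * k * x)) *
    ((k : ℝ) ^ 2 * (∑' n : ℕ, sinTerm x k (n + 1)) - (k : ℝ) ^ 3 * (∑' n : ℕ, cosTerm x k (n + 1)))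

/-- The right-hand side of the formula; all sums run over `k ≥ 1`. -/
def rhs (x : ℝ) : ℝ :=
  elementaryPart x + (∑' k : ℕ, poleTerm x (k + 1))
    - Real.pi / 2 * (∑' k : ℕ, logTerm x (k + 1))
    - 2 * Real.pi * (∑' k : ℕ, doubleTerm x (k + 1))

end RamanujanPsi

end

open Filter Topology Set

namespace RamanujanPsi

/-! The proof compares derivatives. Between consecutive integers `rhs` and `psi (x + 1)` both have
derivative `∑ 1 / (x + n + 1) ^ 2`, so their difference is constant there. The constants of adjacent
intervals agree, and the behaviour at half-integers shows that they are zero.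

Derivative of `rhs`: let `S` and `C` be the inner sine and cosine sums for a given `k`. Then `C' =
-2π S` and `S' = -2π log |2 sin πx| - 2π k² C`, the logarithm being the derivative of the Clausen
series (`hasDerivAt_clausen`). In the derivative of the `k`-th double term, `S` and `C` therefore
cancel and only the logarithm survives (`hasDerivAt_doubleTerm`). As `∑ k e^{-2πkx} = 1 / (4 sinh²
πx)`, it cancels against the explicit logarithmic term, and the remaining `cot / sinh²` cancels
against part of the derivative of `π cot(πx) / (e^{2πx} - 1)`. What is left is an identity of
rational series (`hasSum_deriv_series`), a consequence of the Mittag-Leffler expansion of `π³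
coth(πx) / sin²(πx)`. That expansion is the product of the series of `π² / sin²` and `π coth`, split
by partial fractions.

Gluing: at an integer the pole of the cotangent term cancels the pole of one term of the first
series, and in the difference between the two sides the logarithms cancel or vanish
(`tendsto_rhs_add_sub_rhs_sub`).

Normalization: at `N + 1/2` the difference is `A log(N + 1/2) + o(1)`, where `A` involves `∑ 1 /
sinh² πk`. Since the difference does not depend on `N`, both `A` and the difference vanish; that sum
need not be known in advance. -/

/-! ### The digamma function: asymptotics, series and derivative. -/

theorem differentiableAt_Gamma {x : ℝ} (hx : 0 < x) : DifferentiableAt ℝ Real.Gamma x :=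
  Real.differentiableAt_Gamma fun m => by
    have : (0 : ℝ) ≤ m := m.cast_nonneg
    linarith

theorem hasDerivAt_log_Gamma {x : ℝ} (hx : 0 < x) :
    HasDerivAt (Real.log ∘ Real.Gamma) (psi x) x :=
  (differentiableAt_Gamma hx).hasDerivAt.log (Real.Gamma_pos_of_pos hx).ne'

theorem log_Gamma_add_one {x : ℝ} (hx : 0 < x) :
    Real.log (Real.Gamma (x + 1)) = Real.log x + Real.log (Real.Gamma x) := by
  rw [Real.Gamma_add_one hx.ne', Real.log_mul hx.ne' (Real.Gamma_pos_of_pos hx).ne']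

theorem psi_add_one {x : ℝ} (hx : 0 < x) : psi (x + 1) = psi x + 1 / x := by
  have h1 : HasDerivAt (fun y => Real.log (Real.Gamma (y + 1))) (psi (x + 1)) x :=
    (hasDerivAt_log_Gamma (by linarith : 0 < x + 1)).comp_add_const x 1
  have h2 : HasDerivAt (fun y => Real.log y + Real.log (Real.Gamma y)) (x⁻¹ + psi x) x :=
    (Real.hasDerivAt_log hx.ne').add (hasDerivAt_log_Gamma hx)
  have h3 : (fun y => Real.log (Real.Gamma (y + 1))) =ᶠ[𝓝 x]
      fun y => Real.log y + Real.log (Real.Gamma y) := by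
    filter_upwards [lt_mem_nhds hx] with y hy using log_Gamma_add_one hy
  rw [h1.unique (h2.congr_of_eventuallyEq h3), one_div, add_comm]

/-- By the functional equation, the chord of the convex function `log Γ` from `x` to `x + 1` has
slope `log x`, which lies between the derivatives at its endpoints. -/
theorem log_le_psi_add_one {x : ℝ} (hx : 0 < x) : Real.log x ≤ psi (x + 1) := by
  have h := Real.convexOn_log_Gamma.slope_le_of_hasDerivAt (mem_Ioi.2 hx)
    (mem_Ioi.2 (by linarith : 0 < x + 1)) (by linarith)
    (hasDerivAt_log_Gamma (by linarith : 0 < x + 1))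
  simpa [slope_def_field, log_Gamma_add_one hx] using h

theorem psi_le_log {x : ℝ} (hx : 0 < x) : psi x ≤ Real.log x := by
  have h := Real.convexOn_log_Gamma.le_slope_of_hasDerivAt (mem_Ioi.2 hx)
    (mem_Ioi.2 (by linarith : 0 < x + 1)) (by linarith) (hasDerivAt_log_Gamma hx)
  simpa [slope_def_field, log_Gamma_add_one hx] using h

theorem tendsto_psi_add_one_sub_log :
    Tendsto (fun x : ℝ => psi (x + 1) - Real.log x) atTop (𝓝 0) := by
  have h0 : Tendsto (fun x : ℝ => 1 / x) atTop (𝓝 0) := by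
    simpa using tendsto_inv_atTop_zero (𝕜 := ℝ)
  refine tendsto_of_tendsto_of_tendsto_of_le_of_le' tendsto_const_nhds h0 ?_ ?_
  · filter_upwards [eventually_gt_atTop 0] with x hx using sub_nonneg.2 (log_le_psi_add_one hx)
  · filter_upwards [eventually_gt_atTop 0] with x hx
    rw [psi_add_one hx]
    linarith [psi_le_log hx]

theorem psi_add_nat {x : ℝ} (hx : 0 < x) (N : ℕ) :
    psi (x + N) = psi x + ∑ n ∈ Finset.range N, 1 / (x + n) := by
  induction N with
  | zero => simp
  | succ N ih =>
    have h : 0 < x + N := by positivity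
    rw [Finset.sum_range_succ, ← add_assoc, ← ih, ← psi_add_one h]
    push_cast
    ring_nf

/-- The recurrence turns partial sums into differences of `psi` at `x + N + 1` and `N + 1`, and
there `psi` is asymptotic to the logarithm. The value `psi 1` is left unevaluated because only the
derivative is used. -/
theorem hasSum_psi_add_one {x : ℝ} (hx : 0 ≤ x) :
    HasSum (fun n : ℕ => 1 / ((n : ℝ) + 1) - 1 / (x + n + 1)) (psi (x + 1) - psi 1) := by
  have hnn : ∀ n : ℕ, 0 ≤ 1 / ((n : ℝ) + 1) - 1 / (x + n + 1) := fun n =>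
    sub_nonneg.2 (one_div_le_one_div_of_le (by positivity) (by linarith))
  rw [hasSum_iff_tendsto_nat_of_nonneg hnn]
  have hN : Tendsto (fun N : ℕ => (N : ℝ)) atTop atTop := tendsto_natCast_atTop_atTop
  have h1 : Tendsto (fun N : ℕ => psi ((N : ℝ) + 1) - Real.log N) atTop (𝓝 0) :=
    tendsto_psi_add_one_sub_log.comp hN
  have h2 : Tendsto (fun N : ℕ => psi (x + N + 1) - Real.log (x + N)) atTop (𝓝 0) :=
    tendsto_psi_add_one_sub_log.comp (tendsto_atTop_add_const_left _ x hN)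
  have h3 : Tendsto (fun N : ℕ => Real.log (x + N) - Real.log N) atTop (𝓝 0) := by
    have h4 : Tendsto (fun N : ℕ => x / (N : ℝ) + 1) atTop (𝓝 (0 + 1)) :=
      (tendsto_const_nhds.div_atTop hN).add_const 1
    have h5 := (Real.continuousAt_log (by norm_num : (0 : ℝ) + 1 ≠ 0)).tendsto.comp h4
    simp only [zero_add, Real.log_one] at h5
    refine h5.congr' ?_
    filter_upwards [eventually_gt_atTop 0] with N hN0
    have hN1 : (0 : ℝ) < N := by exact_mod_cast hN0
    rw [Function.comp_apply, ← Real.log_div (by positivity) hN1.ne', add_div, div_self hN1.ne']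
  have h6 : Tendsto (fun N : ℕ => psi (x + 1) - psi 1 - ((psi (x + N + 1) - Real.log (x + N))
      - (psi ((N : ℝ) + 1) - Real.log N) + (Real.log (x + N) - Real.log N))) atTop
      (𝓝 (psi (x + 1) - psi 1 - (0 - 0 + 0))) := ((h2.sub h1).add h3).const_sub _
  simp only [sub_zero, add_zero] at h6
  refine h6.congr fun N => ?_
  have e1 := psi_add_nat (x := x + 1) (by linarith) N
  have e2 := psi_add_nat (x := 1) one_pos N
  rw [Finset.sum_sub_distrib]
  have e3 : ∑ n ∈ Finset.range N, 1 / (x + 1 + n) = ∑ n ∈ Finset.range N, 1 / (x + n + 1) :=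
    Finset.sum_congr rfl fun n _ => by ring_nf
  have e4 : ∑ n ∈ Finset.range N, 1 / ((1 : ℝ) + n) = ∑ n ∈ Finset.range N, 1 / ((n : ℝ) + 1) :=
    Finset.sum_congr rfl fun n _ => by ring_nf
  rw [e3] at e1
  rw [e4] at e2
  rw [show x + 1 + (N : ℝ) = x + N + 1 by ring] at e1
  rw [show 1 + (N : ℝ) = N + 1 by ring] at e2
  linarith

theorem summable_one_div_nat_add_one_sq : Summable fun n : ℕ => 1 / ((n : ℝ) + 1) ^ 2 := by
  have h := (summable_nat_add_iff 1).2 (Real.summable_one_div_nat_pow (p := 2).2 one_lt_two)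
  simpa using h

theorem hasDerivAt_tsum_Ioo {g g' : ℕ → ℝ → ℝ} {u : ℕ → ℝ} {a b x : ℝ} (hx : x ∈ Ioo a b)
    (hu : Summable u) (hg : ∀ n, ∀ y ∈ Ioo a b, HasDerivAt (g n) (g' n y) y)
    (hg' : ∀ n, ∀ y ∈ Ioo a b, |g' n y| ≤ u n) (h0 : Summable fun n => g n x) :
    HasDerivAt (fun y => ∑' n, g n y) (∑' n, g' n x) x :=
  hasDerivAt_tsum_of_isPreconnected hu isOpen_Ioo isPreconnected_Ioo hg hg' hx h0 hx

theorem hasDerivAt_psi_add_one {x : ℝ} (hx : 0 < x) :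
    HasDerivAt (fun y => psi (y + 1)) (∑' n : ℕ, 1 / (x + n + 1) ^ 2) x := by
  have key : HasDerivAt (fun y : ℝ => ∑' n : ℕ, (1 / ((n : ℝ) + 1) - 1 / (y + n + 1)))
      (∑' n : ℕ, 1 / (x + n + 1) ^ 2) x := by
    refine hasDerivAt_tsum_Ioo (g := fun (n : ℕ) (y : ℝ) => 1 / ((n : ℝ) + 1) - 1 / (y + n + 1))
      (g' := fun (n : ℕ) (y : ℝ) => 1 / (y + n + 1) ^ 2) (a := 0) (b := x + 1)
      ⟨hx, by linarith⟩ summable_one_div_nat_add_one_sq ?_ ?_ (hasSum_psi_add_one hx.le).summable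
    · intro n y hy
      have hy0 := hy.1
      have hy' : (0 : ℝ) < y + n + 1 := by positivity
      have h := (((hasDerivAt_id y).add_const (n : ℝ)).add_const (1 : ℝ)).inv hy'.ne'
      have h2 := h.const_sub (1 / ((n : ℝ) + 1))
      convert! h2 using 1
      · ext z; simp
      · simp [neg_div]
    · intro n y hy
      have hy' := hy.1
      rw [abs_of_nonneg (by positivity)]
      gcongr
      linarith
  have h2 := key.const_add (psi 1)
  refine h2.congr_of_eventuallyEq ?_
  filter_upwards [lt_mem_nhds hx] with y hy
  rw [(hasSum_psi_add_one hy.le).tsum_eq]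
  ring

/-! ### Staying away from the integers. -/

theorem pos_of_mem_Ioo_nat {m : ℕ} {x : ℝ} (hx : x ∈ Ioo (m : ℝ) (m + 1)) : 0 < x :=
  lt_of_le_of_lt m.cast_nonneg hx.1

theorem intCast_ne_of_mem_Ioo_nat {m : ℕ} {x : ℝ} (hx : x ∈ Ioo (m : ℝ) (m + 1)) (j : ℤ) :
    (j : ℝ) ≠ x := by
  rintro rfl
  have h1 : (m : ℤ) < j := by exact_mod_cast hx.1
  have h2 : j < (m : ℤ) + 1 := by exact_mod_cast hx.2
  omega

theorem sin_pi_mul_ne_zero_of_mem {m : ℕ} {x : ℝ} (hx : x ∈ Ioo (m : ℝ) (m + 1)) :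
    Real.sin (Real.pi * x) ≠ 0 := by
  intro h
  obtain ⟨j, hj⟩ := Real.sin_eq_zero_iff.1 h
  refine intCast_ne_of_mem_Ioo_nat hx j ?_
  rw [mul_comm] at hj
  exact mul_left_cancel₀ Real.pi_ne_zero hj

/-- With `t = |n + 1 - y|` one has `n + 1 ≤ t + B`, and `t / (t + B)` increases in `t`; hence `t` is
at least `δ / (δ + B)` times `n + 1`. The factor `n + 1 + y` supplies the second power. -/
theorem mul_sq_le_abs_sq_sub_sq {y B δ : ℝ} {n : ℕ} (hδ : 0 < δ) (hy : 0 < y) (hyB : y ≤ B)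
    (h : δ ≤ |((n : ℝ) + 1) - y|) :
    δ / (δ + B) * ((n : ℝ) + 1) ^ 2 ≤ |((n : ℝ) + 1) ^ 2 - y ^ 2| := by
  have hn : (0 : ℝ) ≤ n := n.cast_nonneg
  have hB : 0 < B := hy.trans_le hyB
  have h3 : (n : ℝ) + 1 ≤ |((n : ℝ) + 1) - y| + B := by
    have := le_abs_self (((n : ℝ) + 1) - y)
    linarith
  have h4 : δ / (δ + B) * ((n : ℝ) + 1) ≤ |((n : ℝ) + 1) - y| := by
    rw [div_mul_eq_mul_div, div_le_iff₀ (by positivity)]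
    nlinarith
  have h5 : ((n : ℝ) + 1) ^ 2 - y ^ 2 = (((n : ℝ) + 1) - y) * (((n : ℝ) + 1) + y) := by ring
  rw [h5, abs_mul, abs_of_pos (by linarith : 0 < ((n : ℝ) + 1) + y), sq, ← mul_assoc]
  exact mul_le_mul h4 (by linarith) (by positivity) (abs_nonneg _)

/-- Near a nonintegral point, `n ^ 2 - y ^ 2` is bounded below by a multiple of `n ^ 2`. -/
theorem exists_gap {m : ℕ} {x : ℝ} (hx : x ∈ Ioo (m : ℝ) (m + 1)) :
    ∃ a b c : ℝ, 0 < a ∧ (m : ℝ) ≤ a ∧ b ≤ m + 1 ∧ x ∈ Ioo a b ∧ 0 < c ∧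
      ∀ y ∈ Ioo a b, ∀ n : ℕ, c * ((n : ℝ) + 1) ^ 2 ≤ |((n : ℝ) + 1) ^ 2 - y ^ 2| := by
  have hm : (0 : ℝ) ≤ m := m.cast_nonneg
  obtain ⟨h1, h2⟩ := hx
  set δ := min ((x - m) / 2) ((m + 1 - x) / 2) with hδ
  have hδ0 : 0 < δ := lt_min (by linarith) (by linarith)
  have hδ1 : δ ≤ (x - m) / 2 := min_le_left _ _
  have hδ2 : δ ≤ (m + 1 - x) / 2 := min_le_right _ _
  refine ⟨m + δ, m + 1 - δ, δ / (δ + (m + 1)), by linarith, by linarith, by linarith,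
    ⟨by linarith, by linarith⟩, by positivity, fun y hy n => ?_⟩
  obtain ⟨hy1, hy2⟩ := hy
  have hn : (0 : ℝ) ≤ n := n.cast_nonneg
  have hgap : δ ≤ |((n : ℝ) + 1) - y| := by
    rcases le_or_gt (n + 1) m with h | h
    · have : (n : ℝ) + 1 ≤ m := by exact_mod_cast h
      rw [abs_of_neg (by linarith)]
      linarith
    · have : (m : ℝ) ≤ n := by exact_mod_cast Nat.lt_succ_iff.1 h
      rw [abs_of_pos (by linarith)]
      linarith
  exact mul_sq_le_abs_sq_sub_sq hδ0 (by linarith) (by linarith) hgap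

theorem sq_sub_sq_ne_zero {m : ℕ} {x : ℝ} (hx : x ∈ Ioo (m : ℝ) (m + 1)) (n : ℕ) :
    ((n : ℝ) + 1) ^ 2 - x ^ 2 ≠ 0 := by
  obtain ⟨a, b, c, -, -, -, hxab, hc, h⟩ := exists_gap hx
  have h1 := h x hxab n
  have : 0 < c * ((n : ℝ) + 1) ^ 2 := by positivity
  exact abs_pos.1 (by linarith)

/-! ### Mittag-Leffler expansions and the series identity for the derivative. -/

theorem hasSum_cot {m : ℕ} {x : ℝ} (hx : x ∈ Ioo (m : ℝ) (m + 1)) :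
    HasSum (fun n : ℕ => 2 * x / (x ^ 2 - ((n : ℝ) + 1) ^ 2))
      (Real.pi * Real.cot (Real.pi * x) - 1 / x) := by
  have hz : (x : ℂ) ∈ Complex.integerComplement := by
    rintro ⟨j, hj⟩
    exact intCast_ne_of_mem_Ioo_nat hx j (by exact_mod_cast hj)
  have hs := (summable_cotTerm hz).hasSum
  have e := cot_series_rep' hz
  simp only [cotTerm_identity hz] at hs
  have e2 : (∑' n : ℕ, 2 * (x : ℂ) * (1 / ((x + (n + 1)) * (x - (n + 1)))))
      = Real.pi * Complex.cot (Real.pi * x) - 1 / x := by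
    rw [e]
    exact tsum_congr fun n => (cotTerm_identity hz n).symm
  rw [e2] at hs
  rw [← Complex.hasSum_ofReal]
  convert! hs using 1
  · ext n
    push_cast
    rw [show ((x : ℂ) + (n + 1)) * (x - (n + 1)) = x ^ 2 - (n + 1) ^ 2 by ring, mul_one_div]
  · push_cast
    rfl

/-- This is the cotangent series at `ix`, multiplied by `i`. -/
theorem hasSum_coth {x : ℝ} (hx : 0 < x) :
    HasSum (fun n : ℕ => 2 * x / (x ^ 2 + ((n : ℝ) + 1) ^ 2))
      (Real.pi * (Real.cosh (Real.pi * x) / Real.sinh (Real.pi * x)) - 1 / x) := by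
  have hz : (x : ℂ) * Complex.I ∈ Complex.integerComplement := by
    rintro ⟨j, hj⟩
    have := congrArg Complex.im hj
    simp at this
    exact hx.ne this
  have hs := (summable_cotTerm hz).hasSum
  have e := cot_series_rep' hz
  simp only [cotTerm_identity hz] at hs
  have e2 : (∑' n : ℕ, 2 * ((x : ℂ) * Complex.I) *
        (1 / ((x * Complex.I + (n + 1)) * (x * Complex.I - (n + 1)))))
      = Real.pi * Complex.cot (Real.pi * (x * Complex.I)) - 1 / (x * Complex.I) := by
    rw [e]
    exact tsum_congr fun n => (cotTerm_identity hz n).symm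
  rw [e2] at hs
  have hs' := hs.mul_left Complex.I
  rw [← Complex.hasSum_ofReal]
  have hx' : (x : ℂ) ≠ 0 := by exact_mod_cast hx.ne'
  convert! hs' using 1
  · ext n
    have h1 : ((x : ℂ) * Complex.I + (n + 1)) * (x * Complex.I - (n + 1))
        = -(x ^ 2 + (n + 1) ^ 2) := by
      linear_combination (x : ℂ) ^ 2 * Complex.I_sq
    rw [h1]
    push_cast
    rw [mul_one_div, ← mul_div_assoc, div_neg, ← neg_div]
    congr 1
    linear_combination (2 * x : ℂ) * Complex.I_sq
  · push_cast
    rw [Complex.cot, ← mul_assoc, Complex.cos_mul_I, Complex.sin_mul_I]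
    have hsinh : Complex.sinh (Real.pi * x) ≠ 0 := by
      have : Real.sinh (Real.pi * x) ≠ 0 := by
        rw [Real.sinh_ne_zero]; exact (mul_pos Real.pi_pos hx).ne'
      exact_mod_cast this
    have hI := Complex.I_ne_zero
    field_simp

theorem hasDerivAt_cot {y : ℝ} (hy : Real.sin y ≠ 0) :
    HasDerivAt Real.cot (-(1 / Real.sin y ^ 2)) y := by
  have h := (Real.hasDerivAt_cos y).div (Real.hasDerivAt_sin y) hy
  have e : Real.cot = Real.cos / Real.sin := by
    ext z; simp [Real.cot_eq_cos_div_sin]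
  rw [e]
  convert! h using 1
  rw [← neg_div]
  congr 1
  linear_combination Real.sin_sq_add_cos_sq y

theorem hasDerivAt_cot_pi_mul {x : ℝ} (hx : Real.sin (Real.pi * x) ≠ 0) :
    HasDerivAt (fun y => Real.cot (Real.pi * y)) (-(Real.pi / Real.sin (Real.pi * x) ^ 2)) x := by
  have h := (hasDerivAt_cot hx).comp x ((hasDerivAt_id x).const_mul Real.pi)
  convert! h using 1
  simp
  ring

theorem hasDerivAt_coth_pi_mul {x : ℝ} (hx : 0 < x) :
    HasDerivAt (fun y => Real.cosh (Real.pi * y) / Real.sinh (Real.pi * y))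
      (-(Real.pi / Real.sinh (Real.pi * x) ^ 2)) x := by
  have hs : Real.sinh (Real.pi * x) ≠ 0 := by
    rw [Real.sinh_ne_zero]; exact (mul_pos Real.pi_pos hx).ne'
  have h0 := (hasDerivAt_id x).const_mul Real.pi
  have h := h0.cosh.div h0.sinh hs
  convert! h using 1
  simp only [id, mul_one]
  rw [← neg_div]
  congr 1
  linear_combination Real.pi * Real.cosh_sq (Real.pi * x)

/-- The cotangent series is differentiated term by term, with a locally uniform majorant from
`exists_gap`, and compared with the derivative of its closed form. -/
theorem hasSum_one_div_sin_sq {m : ℕ} {x : ℝ} (hx : x ∈ Ioo (m : ℝ) (m + 1)) :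
    HasSum (fun n : ℕ => 2 * (x ^ 2 + ((n : ℝ) + 1) ^ 2) / (x ^ 2 - ((n : ℝ) + 1) ^ 2) ^ 2)
      (Real.pi ^ 2 / Real.sin (Real.pi * x) ^ 2 - 1 / x ^ 2) := by
  obtain ⟨a, b, c, ha, hma, hb, hxab, hc, hgap⟩ := exists_gap hx
  have hsub : ∀ y ∈ Ioo a b, y ∈ Ioo (m : ℝ) (m + 1) := fun y hy =>
    ⟨lt_of_le_of_lt hma hy.1, lt_of_lt_of_le hy.2 hb⟩
  set u : ℕ → ℝ := fun n => 2 * ((m + 1) ^ 2 + 1) / c ^ 2 * (1 / ((n : ℝ) + 1) ^ 2) with hu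
  have hus : Summable u := summable_one_div_nat_add_one_sq.mul_left _
  have hbd : ∀ n : ℕ, ∀ y ∈ Ioo a b,
      |-(2 * (y ^ 2 + ((n : ℝ) + 1) ^ 2) / (y ^ 2 - ((n : ℝ) + 1) ^ 2) ^ 2)| ≤ u n := by
    intro n y hy
    have h1 := hgap y hy n
    have hy0 : 0 < y := ha.trans hy.1
    have hy1 : y < m + 1 := (hsub y hy).2
    rw [abs_neg, abs_of_nonneg (by positivity),
      show (y ^ 2 - ((n : ℝ) + 1) ^ 2) ^ 2 = |((n : ℝ) + 1) ^ 2 - y ^ 2| ^ 2 by rw [sq_abs]; ring]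
    have h2 : y ^ 2 ≤ (m + 1) ^ 2 * ((n : ℝ) + 1) ^ 2 := by
      rw [← mul_pow]
      have hn : (0 : ℝ) ≤ n := n.cast_nonneg
      gcongr
      nlinarith
    calc 2 * (y ^ 2 + ((n : ℝ) + 1) ^ 2) / |((n : ℝ) + 1) ^ 2 - y ^ 2| ^ 2
        ≤ 2 * ((m + 1) ^ 2 * ((n : ℝ) + 1) ^ 2 + ((n : ℝ) + 1) ^ 2) /
          (c * ((n : ℝ) + 1) ^ 2) ^ 2 := by gcongr
      _ = u n := by
        rw [hu]
        field_simp
  have hd : HasDerivAt (fun y : ℝ => ∑' n : ℕ, 2 * y / (y ^ 2 - ((n : ℝ) + 1) ^ 2))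
      (∑' n : ℕ, -(2 * (x ^ 2 + ((n : ℝ) + 1) ^ 2) / (x ^ 2 - ((n : ℝ) + 1) ^ 2) ^ 2)) x := by
    refine hasDerivAt_tsum_Ioo (g := fun (n : ℕ) (y : ℝ) => 2 * y / (y ^ 2 - ((n : ℝ) + 1) ^ 2))
      (g' := fun (n : ℕ) (y : ℝ) =>
        -(2 * (y ^ 2 + ((n : ℝ) + 1) ^ 2) / (y ^ 2 - ((n : ℝ) + 1) ^ 2) ^ 2))
      hxab hus ?_ hbd (hasSum_cot hx).summable
    intro n y hy
    have h0 : y ^ 2 - ((n : ℝ) + 1) ^ 2 ≠ 0 := by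
      have := sq_sub_sq_ne_zero (hsub y hy) n
      contrapose! this
      linarith
    have h := ((hasDerivAt_id y).const_mul 2).div
      (((hasDerivAt_id y).pow 2).sub_const (((n : ℝ) + 1) ^ 2)) h0
    convert! h using 1
    rw [← neg_div]
    congr 1
    simp
    ring
  have hd2 : HasDerivAt (fun y : ℝ => ∑' n : ℕ, 2 * y / (y ^ 2 - ((n : ℝ) + 1) ^ 2))
      (Real.pi * (-(Real.pi / Real.sin (Real.pi * x) ^ 2)) - (-(x ^ 2)⁻¹)) x := by
    have h := ((hasDerivAt_cot_pi_mul (sin_pi_mul_ne_zero_of_mem hx)).const_mul Real.pi).sub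
      (hasDerivAt_inv (pos_of_mem_Ioo_nat hx).ne')
    refine h.congr_of_eventuallyEq ?_
    filter_upwards [Ioo_mem_nhds hx.1 hx.2] with y hy
    rw [(hasSum_cot hy).tsum_eq]
    simp
  have hsum : Summable fun n : ℕ =>
      -(2 * (x ^ 2 + ((n : ℝ) + 1) ^ 2) / (x ^ 2 - ((n : ℝ) + 1) ^ 2) ^ 2) :=
    Summable.of_norm_bounded hus fun n => hbd n x hxab
  have h := hsum.hasSum.neg
  rw [hd.unique hd2] at h
  convert! h using 1
  · ext n; ring
  · ring

theorem hasSum_one_div_sinh_sq {x : ℝ} (hx : 0 < x) :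
    HasSum (fun n : ℕ => 2 * (((n : ℝ) + 1) ^ 2 - x ^ 2) / (x ^ 2 + ((n : ℝ) + 1) ^ 2) ^ 2)
      (1 / x ^ 2 - Real.pi ^ 2 / Real.sinh (Real.pi * x) ^ 2) := by
  have hus : Summable fun n : ℕ => 2 * (1 / ((n : ℝ) + 1) ^ 2) :=
    summable_one_div_nat_add_one_sq.mul_left _
  have hbd : ∀ n : ℕ, ∀ y ∈ Ioo 0 (x + 1),
      |2 * (((n : ℝ) + 1) ^ 2 - y ^ 2) / (y ^ 2 + ((n : ℝ) + 1) ^ 2) ^ 2|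
        ≤ 2 * (1 / ((n : ℝ) + 1) ^ 2) := by
    intro n y hy
    rw [abs_div, abs_mul, abs_of_pos (by norm_num : (0 : ℝ) < 2),
      abs_of_pos (by positivity : 0 < (y ^ 2 + ((n : ℝ) + 1) ^ 2) ^ 2)]
    have h1 : |((n : ℝ) + 1) ^ 2 - y ^ 2| ≤ y ^ 2 + ((n : ℝ) + 1) ^ 2 := by
      rw [abs_le]
      constructor <;> nlinarith [sq_nonneg y, sq_nonneg ((n : ℝ) + 1)]
    calc 2 * |((n : ℝ) + 1) ^ 2 - y ^ 2| / (y ^ 2 + ((n : ℝ) + 1) ^ 2) ^ 2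
        ≤ 2 * (y ^ 2 + ((n : ℝ) + 1) ^ 2) / (y ^ 2 + ((n : ℝ) + 1) ^ 2) ^ 2 := by gcongr
      _ = 2 * (1 / (y ^ 2 + ((n : ℝ) + 1) ^ 2)) := by field_simp
      _ ≤ 2 * (1 / ((n : ℝ) + 1) ^ 2) := by
        gcongr
        nlinarith [sq_nonneg y]
  have hxab : x ∈ Ioo 0 (x + 1) := ⟨hx, by linarith⟩
  have hd : HasDerivAt (fun y : ℝ => ∑' n : ℕ, 2 * y / (y ^ 2 + ((n : ℝ) + 1) ^ 2))
      (∑' n : ℕ, 2 * (((n : ℝ) + 1) ^ 2 - x ^ 2) / (x ^ 2 + ((n : ℝ) + 1) ^ 2) ^ 2) x := by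
    refine hasDerivAt_tsum_Ioo (g := fun (n : ℕ) (y : ℝ) => 2 * y / (y ^ 2 + ((n : ℝ) + 1) ^ 2))
      (g' := fun (n : ℕ) (y : ℝ) =>
        2 * (((n : ℝ) + 1) ^ 2 - y ^ 2) / (y ^ 2 + ((n : ℝ) + 1) ^ 2) ^ 2)
      hxab hus ?_ hbd (hasSum_coth hx).summable
    intro n y hy
    have h0 : y ^ 2 + ((n : ℝ) + 1) ^ 2 ≠ 0 := by positivity
    have h := ((hasDerivAt_id y).const_mul 2).div
      (((hasDerivAt_id y).pow 2).add_const (((n : ℝ) + 1) ^ 2)) h0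
    convert! h using 1
    congr 1
    simp
    ring
  have hd2 : HasDerivAt (fun y : ℝ => ∑' n : ℕ, 2 * y / (y ^ 2 + ((n : ℝ) + 1) ^ 2))
      (Real.pi * (-(Real.pi / Real.sinh (Real.pi * x) ^ 2)) - (-(x ^ 2)⁻¹)) x := by
    have h := ((hasDerivAt_coth_pi_mul hx).const_mul Real.pi).sub (hasDerivAt_inv hx.ne')
    refine h.congr_of_eventuallyEq ?_
    filter_upwards [lt_mem_nhds hx] with y hy
    rw [(hasSum_coth hy).tsum_eq]
    simp
  have hsum : Summable fun n : ℕ =>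
      2 * (((n : ℝ) + 1) ^ 2 - x ^ 2) / (x ^ 2 + ((n : ℝ) + 1) ^ 2) ^ 2 :=
    Summable.of_norm_bounded hus fun n => hbd n x hxab
  have h := hsum.hasSum
  rw [hd.unique hd2] at h
  convert! h using 1
  ring

theorem exp_two_pi_mul_sub_one_pos {x : ℝ} (hx : 0 < x) : 0 < Real.exp (2 * Real.pi * x) - 1 := by
  have := Real.add_one_lt_exp (mul_pos Real.two_pi_pos hx).ne'
  have := mul_pos Real.two_pi_pos hx
  linarith

theorem sinh_pi_mul_pos {x : ℝ} (hx : 0 < x) : 0 < Real.sinh (Real.pi * x) :=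
  Real.sinh_pos_iff.2 (mul_pos Real.pi_pos hx)

theorem coth_pi_mul_eq {x : ℝ} (hx : 0 < x) :
    Real.cosh (Real.pi * x) / Real.sinh (Real.pi * x)
      = 1 + 2 / (Real.exp (2 * Real.pi * x) - 1) := by
  have h1 := exp_two_pi_mul_sub_one_pos hx
  have h2 := sinh_pi_mul_pos hx
  have h3 := Real.exp_pos (Real.pi * x)
  have e : Real.exp (2 * Real.pi * x) = Real.exp (Real.pi * x) ^ 2 := by
    rw [← Real.exp_nat_mul]; ring_nf
  rw [e] at h1 ⊢
  rw [Real.sinh_eq] at h2 ⊢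
  rw [Real.cosh_eq]
  rw [Real.exp_neg] at h2 ⊢
  have h4 : Real.exp (Real.pi * x) ^ 2 - 1 ≠ 0 := h1.ne'
  field_simp
  ring

theorem summable_mul_one_div_sq_one_div_sq :
    Summable fun p : ℕ × ℕ => 1 / ((p.1 : ℝ) + 1) ^ 2 * (1 / ((p.2 : ℝ) + 1) ^ 2) :=
  summable_one_div_nat_add_one_sq.mul_of_nonneg summable_one_div_nat_add_one_sq
    (fun n => by positivity) (fun n => by positivity)

/-- One factor is at most `1 / M²`, the other at most `1 / K²`. This absolute convergence justifies
the interchange of summations in the product expansion. -/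
theorem summable_cross_term (x : ℝ) : Summable fun p : ℕ × ℕ =>
    4 * x * ((((p.1 : ℝ) + 1) ^ 2 - ((p.2 : ℝ) + 1) ^ 2)
      / (((p.1 : ℝ) + 1) ^ 2 + ((p.2 : ℝ) + 1) ^ 2) ^ 2) / (x ^ 2 + ((p.2 : ℝ) + 1) ^ 2) := by
  refine Summable.of_norm_bounded (summable_mul_one_div_sq_one_div_sq.mul_left (4 * |x|))
    fun p => ?_
  set M := (p.1 : ℝ) + 1 with hM
  set K := (p.2 : ℝ) + 1 with hK
  have hM0 : 0 < M := by positivity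
  have hK0 : 0 < K := by positivity
  rw [Real.norm_eq_abs, abs_div, abs_mul, abs_mul, abs_div,
    abs_of_pos (by norm_num : (0 : ℝ) < 4), abs_of_pos (by positivity : 0 < (M ^ 2 + K ^ 2) ^ 2),
    abs_of_pos (by positivity : 0 < x ^ 2 + K ^ 2)]
  have h1 : |M ^ 2 - K ^ 2| ≤ M ^ 2 + K ^ 2 := by
    rw [abs_le]
    constructor <;> nlinarith [sq_nonneg M, sq_nonneg K]
  have h2 : |M ^ 2 - K ^ 2| / (M ^ 2 + K ^ 2) ^ 2 ≤ 1 / M ^ 2 := by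
    rw [div_le_div_iff₀ (by positivity) (by positivity)]
    nlinarith [sq_nonneg M, sq_nonneg K, abs_nonneg (M ^ 2 - K ^ 2), mul_pos hM0 hM0]
  calc 4 * |x| * (|M ^ 2 - K ^ 2| / (M ^ 2 + K ^ 2) ^ 2) / (x ^ 2 + K ^ 2)
      ≤ 4 * |x| * (1 / M ^ 2) / K ^ 2 := by
        gcongr
        nlinarith [sq_nonneg x]
    _ = 4 * |x| * (1 / M ^ 2 * (1 / K ^ 2)) := by ring

/-- Partial fractions of one term of the product of the series for `1 / sin ^ 2` and `coth`. -/
theorem product_term_eq {x M K : ℝ} (h1 : x ^ 2 - M ^ 2 ≠ 0) (hM : 0 < M) (hK : 0 < K) :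
    2 * (x ^ 2 + M ^ 2) / (x ^ 2 - M ^ 2) ^ 2 * (2 * x / (x ^ 2 + K ^ 2))
      = 4 * x * M / (x ^ 2 - M ^ 2) ^ 2 * (2 * M / (M ^ 2 + K ^ 2))
        + 2 * x / (x ^ 2 - M ^ 2) * (2 * (K ^ 2 - M ^ 2) / (M ^ 2 + K ^ 2) ^ 2)
        + 4 * x * ((M ^ 2 - K ^ 2) / (M ^ 2 + K ^ 2) ^ 2) / (x ^ 2 + K ^ 2) := by
  have h2 : x ^ 2 + K ^ 2 ≠ 0 := by positivity
  have h3 : M ^ 2 + K ^ 2 ≠ 0 := by positivity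
  field_simp
  ring

/-- The Mittag-Leffler expansion of `π ^ 3 coth (π x) / sin (π x) ^ 2`. -/
theorem hasSum_one_div_sin_sq_mul_coth {m : ℕ} {x : ℝ} (hx : x ∈ Ioo (m : ℝ) (m + 1)) :
    HasSum (fun n : ℕ =>
      4 * Real.pi * x * ((n : ℝ) + 1) * (Real.cosh (Real.pi * ((n : ℝ) + 1))
          / Real.sinh (Real.pi * ((n : ℝ) + 1))) / (((n : ℝ) + 1) ^ 2 - x ^ 2) ^ 2
        + 4 * Real.pi ^ 2 * x ^ 3
          / ((((n : ℝ) + 1) ^ 4 - x ^ 4) * Real.sinh (Real.pi * ((n : ℝ) + 1)) ^ 2))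
      (Real.pi ^ 2 / Real.sin (Real.pi * x) ^ 2
          * (Real.pi * (Real.cosh (Real.pi * x) / Real.sinh (Real.pi * x)))
        - 1 / x ^ 3 - 2 * Real.pi ^ 2 / (3 * x)) := by
  have hx0 := pos_of_mem_Ioo_nat hx
  have hne : ∀ n : ℕ, x ^ 2 - ((n : ℝ) + 1) ^ 2 ≠ 0 := fun n => by
    have := sq_sub_sq_ne_zero hx n
    contrapose! this
    linarith
  set C := Real.pi ^ 2 / Real.sin (Real.pi * x) ^ 2 - 1 / x ^ 2 with hC
  set H := Real.pi * (Real.cosh (Real.pi * x) / Real.sinh (Real.pi * x)) - 1 / x with hH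
  have hCs : HasSum (fun n : ℕ => 2 * (x ^ 2 + ((n : ℝ) + 1) ^ 2)
    / (x ^ 2 - ((n : ℝ) + 1) ^ 2) ^ 2) C := hasSum_one_div_sin_sq hx
  have hHs : HasSum (fun n : ℕ => 2 * x / (x ^ 2 + ((n : ℝ) + 1) ^ 2)) H := hasSum_coth hx0
  -- `B` is the part of the partial fractions whose poles in `x` depend only on the second index. It
  -- is summed over the first index instead, giving `β`; the other two parts are summed over the
  -- second index, giving `a`.
  set B : ℕ → ℕ → ℝ := fun i k =>
    4 * x * ((((i : ℝ) + 1) ^ 2 - ((k : ℝ) + 1) ^ 2)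
      / (((i : ℝ) + 1) ^ 2 + ((k : ℝ) + 1) ^ 2) ^ 2) / (x ^ 2 + ((k : ℝ) + 1) ^ 2) with hB
  have hBs : Summable (Function.uncurry B) := summable_cross_term x
  set a : ℕ → ℝ := fun n =>
    4 * x * ((n : ℝ) + 1) / (x ^ 2 - ((n : ℝ) + 1) ^ 2) ^ 2
        * (Real.pi * (Real.cosh (Real.pi * ((n : ℝ) + 1)) / Real.sinh (Real.pi * ((n : ℝ) + 1)))
          - 1 / ((n : ℝ) + 1))
      + 2 * x / (x ^ 2 - ((n : ℝ) + 1) ^ 2) * (1 / ((n : ℝ) + 1) ^ 2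
        - Real.pi ^ 2 / Real.sinh (Real.pi * ((n : ℝ) + 1)) ^ 2) with ha
  set β : ℕ → ℝ := fun n =>
    2 * x / (x ^ 2 + ((n : ℝ) + 1) ^ 2) * (1 / ((n : ℝ) + 1) ^ 2
        - Real.pi ^ 2 / Real.sinh (Real.pi * ((n : ℝ) + 1)) ^ 2) with hβ
  have hrow : ∀ n : ℕ, 2 * (x ^ 2 + ((n : ℝ) + 1) ^ 2) / (x ^ 2 - ((n : ℝ) + 1) ^ 2) ^ 2 * H
      = a n + ∑' k, B n k := by
    intro n
    have hn : (0 : ℝ) < (n : ℝ) + 1 := by positivity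
    have h1 := hHs.mul_left
      (2 * (x ^ 2 + ((n : ℝ) + 1) ^ 2) / (x ^ 2 - ((n : ℝ) + 1) ^ 2) ^ 2)
    have h2 := (((hasSum_coth hn).mul_left
      (4 * x * ((n : ℝ) + 1) / (x ^ 2 - ((n : ℝ) + 1) ^ 2) ^ 2)).add
      ((hasSum_one_div_sinh_sq hn).mul_left (2 * x / (x ^ 2 - ((n : ℝ) + 1) ^ 2)))).add
      (hBs.prod_factor n).hasSum
    refine h1.unique ?_
    convert! h2 using 1
    ext k
    exact product_term_eq (hne n) hn (by positivity)
  have hcol : ∀ k : ℕ, ∑' n, B n k = β k := by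
    intro k
    have hk : (0 : ℝ) < (k : ℝ) + 1 := by positivity
    have h := (hasSum_one_div_sinh_sq hk).mul_left (2 * x / (x ^ 2 + ((k : ℝ) + 1) ^ 2))
    change _ = 2 * x / (x ^ 2 + ((k : ℝ) + 1) ^ 2) * (1 / ((k : ℝ) + 1) ^ 2
        - Real.pi ^ 2 / Real.sinh (Real.pi * ((k : ℝ) + 1)) ^ 2)
    rw [← h.tsum_eq]
    refine tsum_congr fun n => ?_
    rw [hB]
    dsimp only
    rw [add_comm (((n : ℝ) + 1) ^ 2)]
    ring
  have hBrow : HasSum (fun n => ∑' k, B n k) (∑' k, β k) := by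
    have h := hBs.prod.hasSum
    simp only [Function.uncurry_apply_pair] at h
    rwa [← hBs.tsum_comm, tsum_congr hcol] at h
  have hβs : Summable β := by
    have h := hBs.prod_symm.prod
    simp only [Prod.swap_prod_mk, Function.uncurry_apply_pair] at h
    exact h.congr fun k => (hcol k)
  have has : HasSum a (C * H - ∑' k, β k) := by
    refine ((hCs.mul_right H).sub hBrow).congr_fun ?_
    intro n
    rw [hrow]
    ring
  have hab : HasSum (fun n => a n + β n) (C * H) := by
    simpa using has.add hβs.hasSum
  -- The terms free of hyperbolic functions add up to `4 / (x N²)`, so this multiple of `ζ(2)` has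
  -- to be subtracted; it produces `2π² / (3x)`.
  have hz : HasSum (fun n : ℕ => 4 / x * (1 / ((n : ℝ) + 1) ^ 2)) (4 / x * (Real.pi ^ 2 / 6)) := by
    have h := (hasSum_nat_add_iff' 1).2 hasSum_zeta_two
    simp at h
    simpa using h.mul_left (4 / x)
  -- With `C` and `H` lacking their polar parts, `(C + 1/x²)(H + 1/x) = C H + C/x + H/x² + 1/x³`.
  have hfin := (((hHs.mul_left (1 / x ^ 2)).add (hCs.mul_left (1 / x))).add hab).sub hz
  convert! hfin using 1
  · ext n
    set N := (n : ℝ) + 1 with hN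
    have hN0 : 0 < N := by positivity
    have hs := (sinh_pi_mul_pos hN0).ne'
    have hn : x ^ 2 - N ^ 2 ≠ 0 := hne n
    have hn2 : N ^ 2 - x ^ 2 ≠ 0 := sq_sub_sq_ne_zero hx n
    have hp : x ^ 2 + N ^ 2 ≠ 0 := by positivity
    have h4 : N ^ 4 - x ^ 4 = -((x ^ 2 - N ^ 2) * (x ^ 2 + N ^ 2)) := by ring
    have h5 : (N ^ 2 - x ^ 2) ^ 2 = (x ^ 2 - N ^ 2) ^ 2 := by ring
    rw [ha, hβ]
    dsimp only
    rw [h4, h5, ← hN]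
    field_simp
    ring
  · rw [hC, hH]
    field_simp
    ring

/-- Substitute `coth πt = 1 + 2 / (e^{2πt} - 1)` at `t = x` and at the integers. The summand `1`
contributes `(1/(N-x)² - 1/(N+x)²) / 2`; this is cancelled by adding the trigamma series and
subtracting half of the series for `π² / sin²`, which is how the trigamma series enters. -/
theorem hasSum_deriv_series {m : ℕ} {x : ℝ} (hx : x ∈ Ioo (m : ℝ) (m + 1)) :
    HasSum (fun n : ℕ =>
      4 * ((n : ℝ) + 1) * x
          / ((Real.exp (2 * Real.pi * ((n : ℝ) + 1)) - 1) * (((n : ℝ) + 1) ^ 2 - x ^ 2) ^ 2)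
        + 2 * Real.pi * x ^ 3
          / ((((n : ℝ) + 1) ^ 4 - x ^ 4) * Real.sinh (Real.pi * ((n : ℝ) + 1)) ^ 2))
      ((∑' n : ℕ, 1 / (x + n + 1) ^ 2) - Real.pi / (3 * x) + 1 / (2 * x ^ 2)
        - 1 / (2 * Real.pi * x ^ 3)
        + Real.pi ^ 2 / Real.sin (Real.pi * x) ^ 2 / (Real.exp (2 * Real.pi * x) - 1)) := by
  have hx0 := pos_of_mem_Ioo_nat hx
  have hp : Summable fun n : ℕ => 1 / (x + n + 1) ^ 2 := by
    refine Summable.of_nonneg_of_le (fun n => by positivity) (fun n => ?_)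
      summable_one_div_nat_add_one_sq
    gcongr
    linarith
  have h := (((hasSum_one_div_sin_sq_mul_coth hx).mul_left (1 / (2 * Real.pi))).add hp.hasSum).sub
    ((hasSum_one_div_sin_sq hx).mul_left (1 / 2))
  convert! h using 1
  · ext n
    have hn2 : ((n : ℝ) + 1) ^ 2 - x ^ 2 ≠ 0 := sq_sub_sq_ne_zero hx n
    rw [show x + (n : ℝ) + 1 = x + ((n : ℝ) + 1) by ring]
    set N := (n : ℝ) + 1 with hN
    have hN0 : 0 < N := by positivity
    have hs := (sinh_pi_mul_pos hN0).ne'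
    have hE := (exp_two_pi_mul_sub_one_pos hN0).ne'
    have hp : x ^ 2 + N ^ 2 ≠ 0 := by positivity
    have hxN : x + N ≠ 0 := by positivity
    have hNx : N - x ≠ 0 := by
      intro h0
      apply hn2
      linear_combination (N + x) * h0
    have h4 : N ^ 4 - x ^ 4 = (N - x) * (x + N) * (x ^ 2 + N ^ 2) := by ring
    have h5 : (x ^ 2 - N ^ 2) ^ 2 = ((N - x) * (x + N)) ^ 2 := by ring
    have h6 : (N ^ 2 - x ^ 2) ^ 2 = ((N - x) * (x + N)) ^ 2 := by ring
    rw [coth_pi_mul_eq hN0, h4, h5, h6]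
    have hpi := Real.pi_ne_zero
    field_simp
    ring
  · rw [coth_pi_mul_eq hx0]
    have hs := sin_pi_mul_ne_zero_of_mem hx
    have hE := (exp_two_pi_mul_sub_one_pos hx0).ne'
    have hpi := Real.pi_ne_zero
    generalize Real.exp (2 * Real.pi * x) - 1 = E at *
    generalize Real.sin (Real.pi * x) = s at *
    generalize ∑' n : ℕ, 1 / (x + n + 1) ^ 2 = T at *
    field_simp
    ring

/-! ### The Clausen series and the inner series. -/

/-- Real part of the Taylor series of `-log (1 - z)` at `z = r e^{2πix}`. -/
theorem hasSum_abel_cos {r : ℝ} (hr0 : 0 ≤ r) (hr1 : r < 1) (x : ℝ) :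
    HasSum (fun n : ℕ => r ^ (n + 1) * Real.cos (2 * Real.pi * ((n : ℝ) + 1) * x) / ((n : ℝ) + 1))
      (-(Real.log (1 - 2 * r * Real.cos (2 * Real.pi * x) + r ^ 2) / 2)) := by
  set z : ℂ := r * Complex.exp ((2 * Real.pi * x : ℝ) * Complex.I) with hz
  have hnorm : ‖z‖ < 1 := by
    rw [hz, norm_mul, Complex.norm_exp_ofReal_mul_I, mul_one, Complex.norm_real,
      Real.norm_of_nonneg hr0]
    exact hr1
  have h := Complex.hasSum_re (Complex.hasSum_taylorSeries_neg_log hnorm)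
  have h1 := (hasSum_nat_add_iff' 1).2 h
  simp only [Finset.range_one, Finset.sum_singleton, Nat.cast_zero, div_zero, Complex.zero_re,
    sub_zero] at h1
  convert! h1 using 1
  · ext n
    have e : z ^ (n + 1) = ((r ^ (n + 1) : ℝ) : ℂ)
        * Complex.exp ((2 * Real.pi * ((n : ℝ) + 1) * x : ℝ) * Complex.I) := by
      rw [hz, mul_pow, ← Complex.exp_nat_mul]
      push_cast
      ring_nf
    rw [e, show ((n + 1 : ℕ) : ℂ) = (((n : ℝ) + 1 : ℝ) : ℂ) by push_cast; rfl,
      Complex.div_ofReal_re, Complex.re_ofReal_mul, Complex.exp_ofReal_mul_I_re]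
  · rw [Complex.neg_re, Complex.log_re, neg_inj]
    have e : 1 - 2 * r * Real.cos (2 * Real.pi * x) + r ^ 2 = ‖1 - z‖ ^ 2 := by
      rw [Complex.sq_norm, Complex.normSq_apply, hz]
      simp only [Complex.sub_re, Complex.one_re, Complex.sub_im, Complex.one_im,
        Complex.re_ofReal_mul, Complex.im_ofReal_mul, Complex.exp_ofReal_mul_I_re,
        Complex.exp_ofReal_mul_I_im]
      linear_combination -r ^ 2 * Real.sin_sq_add_cos_sq (2 * Real.pi * x)
    rw [e, Real.log_pow]
    push_cast
    ring

theorem hasDerivAt_sin_two_pi_mul (N x : ℝ) :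
    HasDerivAt (fun y => Real.sin (2 * Real.pi * N * y))
      (2 * Real.pi * N * Real.cos (2 * Real.pi * N * x)) x := by
  have h := ((hasDerivAt_id x).const_mul (2 * Real.pi * N)).sin
  convert! h using 1
  simp
  ring

theorem hasDerivAt_cos_two_pi_mul (N x : ℝ) :
    HasDerivAt (fun y => Real.cos (2 * Real.pi * N * y))
      (-(2 * Real.pi * N * Real.sin (2 * Real.pi * N * x))) x := by
  have h := ((hasDerivAt_id x).const_mul (2 * Real.pi * N)).cos
  convert! h using 1
  simp
  ring

theorem summable_abel_sin {r : ℝ} (hr0 : 0 ≤ r) (hr1 : r < 1) (x : ℝ) :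
    Summable fun n : ℕ =>
      r ^ (n + 1) * Real.sin (2 * Real.pi * ((n : ℝ) + 1) * x) / ((n : ℝ) + 1) ^ 2 := by
  refine Summable.of_norm_bounded summable_one_div_nat_add_one_sq fun n => ?_
  rw [Real.norm_eq_abs, abs_div, abs_mul, abs_of_nonneg (by positivity : 0 ≤ r ^ (n + 1)),
    abs_of_pos (by positivity : 0 < ((n : ℝ) + 1) ^ 2)]
  gcongr
  exact mul_le_one₀ (pow_le_one₀ hr0 hr1.le) (abs_nonneg _) (Real.abs_sin_le_one _)

theorem hasDerivAt_abel_sin {r : ℝ} (hr0 : 0 ≤ r) (hr1 : r < 1) (x : ℝ) :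
    HasDerivAt (fun y => ∑' n : ℕ,
      r ^ (n + 1) * Real.sin (2 * Real.pi * ((n : ℝ) + 1) * y) / ((n : ℝ) + 1) ^ 2)
      (-(Real.pi * Real.log (1 - 2 * r * Real.cos (2 * Real.pi * x) + r ^ 2))) x := by
  have h := hasDerivAt_tsum_Ioo (a := x - 1) (b := x + 1) (x := x)
    (g := fun (n : ℕ) (y : ℝ) =>
      r ^ (n + 1) * Real.sin (2 * Real.pi * ((n : ℝ) + 1) * y) / ((n : ℝ) + 1) ^ 2)
    (g' := fun (n : ℕ) (y : ℝ) => 2 * Real.pi *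
      (r ^ (n + 1) * Real.cos (2 * Real.pi * ((n : ℝ) + 1) * y) / ((n : ℝ) + 1)))
    (u := fun n => 2 * Real.pi * r ^ (n + 1)) ⟨by linarith, by linarith⟩
    (((summable_nat_add_iff 1).2 (summable_geometric_of_lt_one hr0 hr1)).mul_left _) ?_ ?_
    (summable_abel_sin hr0 hr1 x)
  · convert! h using 1
    rw [tsum_mul_left, (hasSum_abel_cos hr0 hr1 x).tsum_eq]
    ring
  · intro n y _
    have h := ((hasDerivAt_sin_two_pi_mul ((n : ℝ) + 1) y).const_mul (r ^ (n + 1))).div_const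
      (((n : ℝ) + 1) ^ 2)
    convert! h using 1
    field_simp
  · intro n y _
    rw [abs_mul, abs_of_pos Real.two_pi_pos]
    gcongr
    rw [abs_div, abs_mul, abs_of_nonneg (by positivity : 0 ≤ r ^ (n + 1)),
      abs_of_pos (by positivity : 0 < (n : ℝ) + 1)]
    have h1 : 0 ≤ r ^ (n + 1) := by positivity
    have h2 := Real.abs_cos_le_one (2 * Real.pi * ((n : ℝ) + 1) * y)
    have h3 : (0 : ℝ) ≤ n := n.cast_nonneg
    rw [div_le_iff₀ (by positivity)]
    nlinarith [mul_le_mul_of_nonneg_left h2 h1, mul_nonneg h1 h3]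

theorem two_sub_two_cos_eq (x : ℝ) :
    1 - 2 * 1 * Real.cos (2 * Real.pi * x) + 1 ^ 2 = (2 * Real.sin (Real.pi * x)) ^ 2 := by
  rw [show 2 * Real.pi * x = 2 * (Real.pi * x) by ring, Real.cos_two_mul]
  linear_combination -4 * Real.sin_sq_add_cos_sq (Real.pi * x)

/-- The derivative of the Clausen series. -/
theorem hasDerivAt_clausen {x : ℝ} (hx : Real.sin (Real.pi * x) ≠ 0) :
    HasDerivAt (fun y => ∑' n : ℕ,
      Real.sin (2 * Real.pi * ((n : ℝ) + 1) * y) / ((n : ℝ) + 1) ^ 2)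
      (-(2 * Real.pi * Real.log |2 * Real.sin (Real.pi * x)|)) x := by
  set G : ℝ → ℝ → ℝ := fun r y =>
    -(Real.pi * Real.log (1 - 2 * r * Real.cos (2 * Real.pi * y) + r ^ 2)) with hG
  have hr : ∀ᶠ r : ℝ in 𝓝[<] 1, 0 ≤ r ∧ r < 1 := by
    filter_upwards [Ioo_mem_nhdsLT (zero_lt_one (α := ℝ))] with r hr using ⟨hr.1.le, hr.2⟩
  have h0 : 1 - 2 * 1 * Real.cos (2 * Real.pi * x) + 1 ^ 2 ≠ 0 := by
    rw [two_sub_two_cos_eq]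
    exact pow_ne_zero _ (mul_ne_zero two_ne_zero hx)
  have hc1 : ContinuousAt (fun p : ℝ × ℝ =>
      1 - 2 * p.1 * Real.cos (2 * Real.pi * p.2) + p.1 ^ 2) (1, x) := by fun_prop
  have hc2 : ContinuousAt (fun p : ℝ × ℝ =>
      1 - 2 * 1 * Real.cos (2 * Real.pi * p.2) + 1 ^ 2) (1, x) := by fun_prop
  have hcont : ContinuousAt (fun p : ℝ × ℝ => G p.1 p.2) (1, x) :=
    ((hc1.log h0).const_mul Real.pi).neg
  have hcont2 : ContinuousAt (fun p : ℝ × ℝ => G 1 p.2) (1, x) :=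
    ((hc2.log h0).const_mul Real.pi).neg
  have key : HasDerivAt (fun y => ∑' n : ℕ,
      Real.sin (2 * Real.pi * ((n : ℝ) + 1) * y) / ((n : ℝ) + 1) ^ 2) (G 1 x) x := by
    -- The formal derivative at `r = 1` converges only conditionally, so it is reached by letting
    -- `r` increase to `1`. Joint continuity of `G` at `(1, x)` gives the uniformity that passage to
    -- the limit requires.
    refine hasDerivAt_of_tendstoUniformlyOnFilter (l := 𝓝[<] (1 : ℝ)) (f' := G) (g' := G 1)
      (f := fun r y => ∑' n : ℕ,
        r ^ (n + 1) * Real.sin (2 * Real.pi * ((n : ℝ) + 1) * y) / ((n : ℝ) + 1) ^ 2) ?_ ?_ ?_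
    · rw [Metric.tendstoUniformlyOnFilter_iff]
      intro ε hε
      have hd : Tendsto (fun p : ℝ × ℝ => dist (G 1 p.2) (G p.1 p.2)) (𝓝 (1, x)) (𝓝 0) := by
        have := hcont2.tendsto.dist hcont.tendsto
        simpa using this
      have hd2 := hd.eventually_lt_const hε
      rw [nhds_prod_eq] at hd2
      exact (Filter.prod_mono_left _ nhdsWithin_le_nhds) hd2
    · filter_upwards [hr.prod_inl (𝓝 x)] with p hp using hasDerivAt_abel_sin hp.1 hp.2 p.2
    · refine Eventually.of_forall fun y => ?_
      refine tendsto_tsum_of_dominated_convergence summable_one_div_nat_add_one_sq ?_ ?_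
      · intro n
        have hc : Tendsto (fun r : ℝ => r ^ (n + 1) * Real.sin (2 * Real.pi * ((n : ℝ) + 1) * y)
            / ((n : ℝ) + 1) ^ 2) (𝓝 1) (𝓝 (1 ^ (n + 1) *
              Real.sin (2 * Real.pi * ((n : ℝ) + 1) * y) / ((n : ℝ) + 1) ^ 2)) :=
          Continuous.tendsto (by fun_prop) 1
        simpa using hc.mono_left nhdsWithin_le_nhds
      · filter_upwards [hr] with r hr n
        rw [Real.norm_eq_abs, abs_div, abs_mul,
          abs_of_nonneg (pow_nonneg hr.1 (n + 1)),
          abs_of_pos (by positivity : 0 < ((n : ℝ) + 1) ^ 2)]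
        gcongr
        exact mul_le_one₀ (pow_le_one₀ hr.1 hr.2.le) (abs_nonneg _) (Real.abs_sin_le_one _)
  convert! key using 1
  rw [hG]
  dsimp only
  rw [two_sub_two_cos_eq, Real.log_pow, Real.log_abs]
  push_cast
  ring

theorem sinTerm_succ (x : ℝ) (k n : ℕ) : sinTerm x k (n + 1) =
    Real.sin (2 * Real.pi * ((n : ℝ) + 1) * x) / ((k : ℝ) ^ 2 + ((n : ℝ) + 1) ^ 2) := by
  rw [sinTerm]
  push_cast
  rfl

theorem cosTerm_succ (x : ℝ) (k n : ℕ) : cosTerm x k (n + 1) =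
    Real.cos (2 * Real.pi * ((n : ℝ) + 1) * x)
      / (((n : ℝ) + 1) * ((k : ℝ) ^ 2 + ((n : ℝ) + 1) ^ 2)) := by
  rw [cosTerm]
  push_cast
  rfl

theorem abs_div_le_one_div_sq {s d : ℝ} {n : ℕ} (hs : |s| ≤ 1) (hd : ((n : ℝ) + 1) ^ 2 ≤ d) :
    |s / d| ≤ 1 / ((n : ℝ) + 1) ^ 2 := by
  have h0 : 0 < ((n : ℝ) + 1) ^ 2 := by positivity
  rw [abs_div, abs_of_pos (h0.trans_le hd)]
  gcongr

theorem sq_le_mul_sq_add_sq (k n : ℕ) :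
    ((n : ℝ) + 1) ^ 2 ≤ ((n : ℝ) + 1) * ((k : ℝ) ^ 2 + ((n : ℝ) + 1) ^ 2) := by
  have hn : (0 : ℝ) ≤ n := n.cast_nonneg
  nlinarith [mul_nonneg hn (sq_nonneg ((n : ℝ) + 1)), mul_nonneg hn (sq_nonneg (k : ℝ)),
    sq_nonneg (k : ℝ)]

theorem abs_sinTerm_le (x : ℝ) (k n : ℕ) : |sinTerm x k (n + 1)| ≤ 1 / ((n : ℝ) + 1) ^ 2 := by
  rw [sinTerm_succ]
  exact abs_div_le_one_div_sq (Real.abs_sin_le_one _) (by nlinarith [sq_nonneg (k : ℝ)])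

theorem abs_cosTerm_le (x : ℝ) (k n : ℕ) : |cosTerm x k (n + 1)| ≤ 1 / ((n : ℝ) + 1) ^ 2 := by
  rw [cosTerm_succ]
  exact abs_div_le_one_div_sq (Real.abs_cos_le_one _) (sq_le_mul_sq_add_sq k n)

theorem summable_sinTerm (x : ℝ) (k : ℕ) : Summable fun n : ℕ => sinTerm x k (n + 1) :=
  Summable.of_norm_bounded summable_one_div_nat_add_one_sq fun n => abs_sinTerm_le x k n

theorem summable_cosTerm (x : ℝ) (k : ℕ) : Summable fun n : ℕ => cosTerm x k (n + 1) :=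
  Summable.of_norm_bounded summable_one_div_nat_add_one_sq fun n => abs_cosTerm_le x k n

theorem hasDerivAt_tsum_cosTerm (x : ℝ) (k : ℕ) :
    HasDerivAt (fun y => ∑' n : ℕ, cosTerm y k (n + 1))
      (-(2 * Real.pi * ∑' n : ℕ, sinTerm x k (n + 1))) x := by
  have h := hasDerivAt_tsum_Ioo (a := x - 1) (b := x + 1) (x := x)
    (g := fun (n : ℕ) (y : ℝ) => cosTerm y k (n + 1))
    (g' := fun (n : ℕ) (y : ℝ) => -(2 * Real.pi) * sinTerm y k (n + 1))
    (u := fun n => 2 * Real.pi * (1 / ((n : ℝ) + 1) ^ 2)) ⟨by linarith, by linarith⟩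
    (summable_one_div_nat_add_one_sq.mul_left _) ?_ ?_ (summable_cosTerm x k)
  · rw [tsum_mul_left] at h
    simpa using h
  · intro n y _
    have h := (hasDerivAt_cos_two_pi_mul ((n : ℝ) + 1) y).div_const
      (((n : ℝ) + 1) * ((k : ℝ) ^ 2 + ((n : ℝ) + 1) ^ 2))
    simp only [cosTerm_succ, sinTerm_succ]
    convert! h using 1
    field_simp
  · intro n y _
    rw [abs_mul, abs_neg, abs_of_pos Real.two_pi_pos]
    gcongr
    exact abs_sinTerm_le y k n

/-- Since `1/(k² + n²) = 1/n² - k² / (n² (k² + n²))`, the sine sum is the Clausen series minus a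
series that can be differentiated term by term. -/
theorem hasDerivAt_tsum_sinTerm {x : ℝ} (hx : Real.sin (Real.pi * x) ≠ 0) (k : ℕ) :
    HasDerivAt (fun y => ∑' n : ℕ, sinTerm y k (n + 1))
      (-(2 * Real.pi * Real.log |2 * Real.sin (Real.pi * x)|)
        - (k : ℝ) ^ 2 * (2 * Real.pi * ∑' n : ℕ, cosTerm x k (n + 1))) x := by
  have hd : ∀ n : ℕ, ((n : ℝ) + 1) ^ 2 ≤ ((n : ℝ) + 1) ^ 2 * ((k : ℝ) ^ 2 + ((n : ℝ) + 1) ^ 2) :=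
    fun n => by
      have hn : (0 : ℝ) ≤ n := n.cast_nonneg
      have h1 : 1 ≤ (k : ℝ) ^ 2 + ((n : ℝ) + 1) ^ 2 := by nlinarith [sq_nonneg (k : ℝ)]
      exact le_mul_of_one_le_right (by positivity) h1
  have hsum : ∀ y : ℝ, Summable fun n : ℕ => Real.sin (2 * Real.pi * ((n : ℝ) + 1) * y)
      / (((n : ℝ) + 1) ^ 2 * ((k : ℝ) ^ 2 + ((n : ℝ) + 1) ^ 2)) := fun y =>
    Summable.of_norm_bounded summable_one_div_nat_add_one_sq fun n =>
      abs_div_le_one_div_sq (Real.abs_sin_le_one _) (hd n)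
  have hcl : ∀ y : ℝ, Summable fun n : ℕ => Real.sin (2 * Real.pi * ((n : ℝ) + 1) * y)
      / ((n : ℝ) + 1) ^ 2 := fun y =>
    Summable.of_norm_bounded summable_one_div_nat_add_one_sq fun n =>
      abs_div_le_one_div_sq (Real.abs_sin_le_one _) le_rfl
  have hZ : HasDerivAt (fun y => ∑' n : ℕ, Real.sin (2 * Real.pi * ((n : ℝ) + 1) * y)
      / (((n : ℝ) + 1) ^ 2 * ((k : ℝ) ^ 2 + ((n : ℝ) + 1) ^ 2)))
      (2 * Real.pi * ∑' n : ℕ, cosTerm x k (n + 1)) x := by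
    rw [← tsum_mul_left]
    refine hasDerivAt_tsum_Ioo (a := x - 1) (b := x + 1) (x := x)
      (g := fun (n : ℕ) (y : ℝ) => Real.sin (2 * Real.pi * ((n : ℝ) + 1) * y)
        / (((n : ℝ) + 1) ^ 2 * ((k : ℝ) ^ 2 + ((n : ℝ) + 1) ^ 2)))
      (g' := fun (n : ℕ) (y : ℝ) => 2 * Real.pi * cosTerm y k (n + 1))
      (u := fun n => 2 * Real.pi * (1 / ((n : ℝ) + 1) ^ 2)) ⟨by linarith, by linarith⟩
      (summable_one_div_nat_add_one_sq.mul_left _) ?_ ?_ (hsum x)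
    · intro n y _
      have h := (hasDerivAt_sin_two_pi_mul ((n : ℝ) + 1) y).div_const
        (((n : ℝ) + 1) ^ 2 * ((k : ℝ) ^ 2 + ((n : ℝ) + 1) ^ 2))
      convert! h using 1
      rw [cosTerm_succ]
      field_simp
    · intro n y _
      rw [abs_mul, abs_of_pos Real.two_pi_pos]
      gcongr
      exact abs_cosTerm_le y k n
  have h := (hasDerivAt_clausen hx).sub (hZ.const_mul ((k : ℝ) ^ 2))
  convert! h using 1
  ext y
  simp only [Pi.sub_apply]
  rw [← tsum_mul_left, ← (hcl y).tsum_sub ((hsum y).mul_left _)]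
  refine tsum_congr fun n => ?_
  rw [sinTerm_succ]
  have h1 : (k : ℝ) ^ 2 + ((n : ℝ) + 1) ^ 2 ≠ 0 := by positivity
  field_simp
  ring

/-! ### The double series. -/

theorem hasDerivAt_exp_neg_mul (c x : ℝ) :
    HasDerivAt (fun y => Real.exp (-(c * y))) (-c * Real.exp (-(c * x))) x := by
  have h := (((hasDerivAt_id x).const_mul c).neg).exp
  convert! h using 1
  simp
  ring

/-- The weights `k²`, `k³` and the exponential are matched to the coupled derivatives of the two
inner sums: every occurrence of those sums cancels. -/
theorem hasDerivAt_doubleTerm {x : ℝ} (hx : Real.sin (Real.pi * x) ≠ 0) (k : ℕ) :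
    HasDerivAt (fun y => doubleTerm y k)
      (-(2 * Real.pi * (k : ℝ) ^ 2 * Real.exp (-(2 * Real.pi * k * x))
        * Real.log |2 * Real.sin (Real.pi * x)|)) x := by
  have h := (hasDerivAt_exp_neg_mul (2 * Real.pi * k) x).mul
    (((hasDerivAt_tsum_sinTerm hx k).const_mul ((k : ℝ) ^ 2)).sub
      ((hasDerivAt_tsum_cosTerm x k).const_mul ((k : ℝ) ^ 3)))
  convert! h using 1
  simp only [Pi.sub_apply]
  ring

theorem hasDerivAt_log_two_sin {x : ℝ} (hx : Real.sin (Real.pi * x) ≠ 0) :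
    HasDerivAt (fun y => Real.log |2 * Real.sin (Real.pi * y)|)
      (Real.pi * Real.cot (Real.pi * x)) x := by
  have h := ((((hasDerivAt_id x).const_mul Real.pi).sin).const_mul 2).log
    (mul_ne_zero two_ne_zero hx)
  simp only [Real.log_abs]
  convert! h using 1
  rw [Real.cot_eq_cos_div_sin]
  simp only [id]
  field_simp

theorem abs_doubleTerm_le {a x : ℝ} (hax : a ≤ x) (k : ℕ) :
    |doubleTerm x k| ≤ ((k : ℝ) ^ 2 + (k : ℝ) ^ 3) * Real.exp (-(2 * Real.pi * k * a))
      * ∑' n : ℕ, 1 / ((n : ℝ) + 1) ^ 2 := by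
  set Z := ∑' n : ℕ, 1 / ((n : ℝ) + 1) ^ 2 with hZ
  have hS : |∑' n : ℕ, sinTerm x k (n + 1)| ≤ Z :=
    tsum_of_norm_bounded (f := fun n => sinTerm x k (n + 1))
      summable_one_div_nat_add_one_sq.hasSum fun n => abs_sinTerm_le x k n
  have hC : |∑' n : ℕ, cosTerm x k (n + 1)| ≤ Z :=
    tsum_of_norm_bounded (f := fun n => cosTerm x k (n + 1))
      summable_one_div_nat_add_one_sq.hasSum fun n => abs_cosTerm_le x k n
  have hE : Real.exp (-(2 * Real.pi * k * x)) ≤ Real.exp (-(2 * Real.pi * k * a)) := by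
    have := Real.pi_pos
    gcongr
  rw [doubleTerm, abs_mul, abs_of_pos (Real.exp_pos _)]
  calc _ ≤ Real.exp (-(2 * Real.pi * k * a)) * ((k : ℝ) ^ 2 * Z + (k : ℝ) ^ 3 * Z) := by
        gcongr
        refine (abs_sub _ _).trans ?_
        rw [abs_mul, abs_mul, abs_of_nonneg (by positivity : 0 ≤ (k : ℝ) ^ 2),
          abs_of_nonneg (by positivity : 0 ≤ (k : ℝ) ^ 3)]
        gcongr
    _ = _ := by ring

theorem summable_pow_mul_exp {a : ℝ} (ha : 0 < a) (p : ℕ) :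
    Summable fun k : ℕ => ((k : ℝ) + 1) ^ p * Real.exp (-(2 * Real.pi * ((k : ℝ) + 1) * a)) := by
  have h := (summable_nat_add_iff 1).2
    (Real.summable_pow_mul_exp_neg_nat_mul p (mul_pos Real.two_pi_pos ha))
  refine h.congr fun k => ?_
  push_cast
  ring_nf

theorem summable_doubleTerm_bound {a : ℝ} (ha : 0 < a) :
    Summable fun k : ℕ => (((k + 1 : ℕ) : ℝ) ^ 2 + ((k + 1 : ℕ) : ℝ) ^ 3)
      * Real.exp (-(2 * Real.pi * ((k + 1 : ℕ) : ℝ) * a)) * ∑' n : ℕ, 1 / ((n : ℝ) + 1) ^ 2 := by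
  refine (((summable_pow_mul_exp ha 2).add (summable_pow_mul_exp ha 3)).mul_right
    (∑' n : ℕ, 1 / ((n : ℝ) + 1) ^ 2)).congr fun k => ?_
  push_cast
  ring

theorem summable_doubleTerm {x : ℝ} (hx : 0 < x) :
    Summable fun k : ℕ => doubleTerm x (k + 1) :=
  Summable.of_norm_bounded (summable_doubleTerm_bound hx) fun k => abs_doubleTerm_le le_rfl (k + 1)

theorem continuous_doubleTerm (k : ℕ) : Continuous fun x => doubleTerm x k := by
  have hS : Continuous fun x : ℝ => ∑' n : ℕ, sinTerm x k (n + 1) := by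
    refine continuous_tsum (fun n => ?_) summable_one_div_nat_add_one_sq
      fun n x => abs_sinTerm_le x k n
    simp only [sinTerm_succ]
    fun_prop
  have hC : Continuous fun x : ℝ => ∑' n : ℕ, cosTerm x k (n + 1) := by
    refine continuous_tsum (fun n => ?_) summable_one_div_nat_add_one_sq
      fun n x => abs_cosTerm_le x k n
    simp only [cosTerm_succ]
    fun_prop
  unfold doubleTerm
  fun_prop

/-- This covers integers too, where the term derivatives have a logarithmic singularity; it is
needed for gluing. -/
theorem continuousAt_tsum_doubleTerm {x : ℝ} (hx : 0 < x) :
    ContinuousAt (fun y => ∑' k : ℕ, doubleTerm y (k + 1)) x := by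
  have h : ContinuousOn (fun y => ∑' k : ℕ, doubleTerm y (k + 1)) (Ioi (x / 2)) :=
    continuousOn_tsum (fun k => (continuous_doubleTerm (k + 1)).continuousOn)
      (summable_doubleTerm_bound (half_pos hx))
      fun k y hy => abs_doubleTerm_le (le_of_lt hy) (k + 1)
  exact h.continuousAt (Ioi_mem_nhds (by linarith))

theorem tendsto_tsum_doubleTerm_atTop :
    Tendsto (fun x => ∑' k : ℕ, doubleTerm x (k + 1)) atTop (𝓝 0) := by
  have h : Tendsto (fun x => ∑' k : ℕ, doubleTerm x (k + 1)) atTop (𝓝 (∑' _ : ℕ, (0 : ℝ))) := by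
    refine tendsto_tsum_of_dominated_convergence (summable_doubleTerm_bound one_pos) ?_ ?_
    · intro k
      refine squeeze_zero_norm (fun x => abs_doubleTerm_le le_rfl (k + 1)) ?_
      have h1 : Tendsto (fun x : ℝ => Real.exp (-(2 * Real.pi * ((k + 1 : ℕ) : ℝ) * x))) atTop
          (𝓝 0) := by
        refine Real.tendsto_exp_neg_atTop_nhds_zero.comp (tendsto_id.const_mul_atTop ?_)
        have := Real.pi_pos
        positivity
      have h2 := (h1.const_mul (((k + 1 : ℕ) : ℝ) ^ 2 + ((k + 1 : ℕ) : ℝ) ^ 3)).mul_const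
        (∑' n : ℕ, 1 / ((n : ℝ) + 1) ^ 2)
      simpa using h2
    · filter_upwards [eventually_ge_atTop 1] with x hx k using abs_doubleTerm_le hx (k + 1)
  simpa using h

theorem one_div_four_sinh_sq {x : ℝ} (hx : 0 < x) :
    1 / (4 * Real.sinh (Real.pi * x) ^ 2)
      = Real.exp (-(2 * Real.pi * x)) / (1 - Real.exp (-(2 * Real.pi * x))) ^ 2 := by
  have h1 := (sinh_pi_mul_pos hx).ne'
  have e : Real.exp (-(2 * Real.pi * x)) = Real.exp (-(Real.pi * x)) ^ 2 := by
    rw [← Real.exp_nat_mul]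
    ring_nf
  have e2 : 1 - Real.exp (-(Real.pi * x)) ^ 2
      = Real.exp (-(Real.pi * x)) * (2 * Real.sinh (Real.pi * x)) := by
    have e3 : Real.exp (-(Real.pi * x)) * Real.exp (Real.pi * x) = 1 := by
      rw [← Real.exp_add, neg_add_cancel, Real.exp_zero]
    rw [Real.sinh_eq]
    linear_combination -e3
  have h3 := (Real.exp_pos (-(Real.pi * x))).ne'
  rw [e, e2]
  generalize Real.exp (-(Real.pi * x)) = E at h3
  generalize Real.sinh (Real.pi * x) = s at h1
  field_simp
  norm_num

/-- This is `∑ k q^k = q / (1 - q)²` at `q = e^{-2πx}`. -/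
theorem hasSum_mul_exp {x : ℝ} (hx : 0 < x) :
    HasSum (fun k : ℕ => ((k : ℝ) + 1) * Real.exp (-(2 * Real.pi * ((k : ℝ) + 1) * x)))
      (1 / (4 * Real.sinh (Real.pi * x) ^ 2)) := by
  have hr : ‖Real.exp (-(2 * Real.pi * x))‖ < 1 := by
    rw [Real.norm_of_nonneg (Real.exp_pos _).le, Real.exp_lt_one_iff]
    have := mul_pos Real.two_pi_pos hx
    linarith
  have h0 : HasSum (fun n : ℕ => (n : ℝ) * Real.exp (-(2 * Real.pi * x)) ^ n)
      (1 / (4 * Real.sinh (Real.pi * x) ^ 2)) := by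
    rw [one_div_four_sinh_sq hx]
    exact hasSum_coe_mul_geometric_of_norm_lt_one hr
  have h : HasSum (fun k : ℕ => ((k + 1 : ℕ) : ℝ) * Real.exp (-(2 * Real.pi * x)) ^ (k + 1))
      (1 / (4 * Real.sinh (Real.pi * x) ^ 2)) := by
    rw [hasSum_nat_add_iff (f := fun n : ℕ => (n : ℝ) * Real.exp (-(2 * Real.pi * x)) ^ n) 1,
      Finset.sum_range_one, Nat.cast_zero, zero_mul, add_zero]
    exact h0
  have e : (fun k : ℕ => ((k : ℝ) + 1) * Real.exp (-(2 * Real.pi * ((k : ℝ) + 1) * x)))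
      = fun k : ℕ => ((k + 1 : ℕ) : ℝ) * Real.exp (-(2 * Real.pi * x)) ^ (k + 1) := by
    ext k
    rw [← Real.exp_nat_mul, Nat.cast_add, Nat.cast_one]
    congr 2
    ring
  rw [e]
  exact h

/-- With `1 / (4 sinh²)` expanded as a series, the two parts are differentiated together: the terms
`2π k² e^{-2πkx} log |2 sin πx|` cancel for each `k`, leaving the cotangent. -/
theorem hasDerivAt_log_sub_doubleSeries {m : ℕ} {x : ℝ} (hx : x ∈ Ioo (m : ℝ) (m + 1)) :
    HasDerivAt (fun y => Real.log |2 * Real.sin (Real.pi * y)| / (4 * Real.sinh (Real.pi * y) ^ 2)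
        - ∑' k : ℕ, doubleTerm y (k + 1))
      (Real.pi * Real.cot (Real.pi * x) / (4 * Real.sinh (Real.pi * x) ^ 2)) x := by
  have hx0 := pos_of_mem_Ioo_nat hx
  have hcot : ContinuousAt (fun y => |Real.pi * Real.cot (Real.pi * y)|) x :=
    ((hasDerivAt_cot_pi_mul (sin_pi_mul_ne_zero_of_mem hx)).continuousAt.const_mul Real.pi).abs
  set B := |Real.pi * Real.cot (Real.pi * x)| + 1 with hB
  -- On this neighbourhood the cotangent is bounded and the exponentials are dominated by those at
  -- `x / 2`.
  have hev : ∀ᶠ y in 𝓝 x, y ∈ Ioo (m : ℝ) (m + 1) ∧ x / 2 < y ∧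
      |Real.pi * Real.cot (Real.pi * y)| < B := by
    filter_upwards [Ioo_mem_nhds hx.1 hx.2, lt_mem_nhds (half_lt_self hx0),
      hcot.eventually_lt_const (lt_add_one _)] with y h1 h2 h3 using ⟨h1, h2, h3⟩
  obtain ⟨a, b, hxab, hsub⟩ := mem_nhds_iff_exists_Ioo_subset.1 hev
  have hsumm : ∀ y, 0 < y → Summable fun k : ℕ => Real.log |2 * Real.sin (Real.pi * y)|
      * (((k : ℝ) + 1) * Real.exp (-(2 * Real.pi * ((k : ℝ) + 1) * y))) := fun y hy =>
    (hasSum_mul_exp hy).summable.mul_left _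
  have h := hasDerivAt_tsum_Ioo (x := x)
    (g := fun (k : ℕ) (y : ℝ) => Real.log |2 * Real.sin (Real.pi * y)|
      * (((k : ℝ) + 1) * Real.exp (-(2 * Real.pi * ((k : ℝ) + 1) * y))) - doubleTerm y (k + 1))
    (g' := fun (k : ℕ) (y : ℝ) => Real.pi * Real.cot (Real.pi * y)
      * (((k : ℝ) + 1) * Real.exp (-(2 * Real.pi * ((k : ℝ) + 1) * y))))
    (u := fun k : ℕ => B * (((k : ℝ) + 1) ^ 1 *
      Real.exp (-(2 * Real.pi * ((k : ℝ) + 1) * (x / 2))))) hxab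
    ((summable_pow_mul_exp (half_pos hx0) 1).mul_left B) ?_ ?_
    ((hsumm x hx0).sub (summable_doubleTerm hx0))
  · rw [tsum_mul_left, (hasSum_mul_exp hx0).tsum_eq, mul_one_div] at h
    refine h.congr_of_eventuallyEq ?_
    filter_upwards [lt_mem_nhds hx0] with y hy
    rw [(hsumm y hy).tsum_sub (summable_doubleTerm hy), tsum_mul_left,
      (hasSum_mul_exp hy).tsum_eq, mul_one_div]
  · intro k y hy
    have hs := sin_pi_mul_ne_zero_of_mem (hsub hy).1
    have h := ((hasDerivAt_log_two_sin hs).mul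
      ((hasDerivAt_exp_neg_mul (2 * Real.pi * ((k : ℝ) + 1)) y).const_mul ((k : ℝ) + 1))).sub
      (hasDerivAt_doubleTerm hs (k + 1))
    convert! h using 1
    push_cast
    ring
  · intro k y hy
    have h1 := (hsub hy).2.1
    have h2 := (hsub hy).2.2
    have hpi := Real.pi_pos
    rw [abs_mul, abs_of_pos (by positivity :
      0 < ((k : ℝ) + 1) * Real.exp (-(2 * Real.pi * ((k : ℝ) + 1) * y))), pow_one]
    gcongr

/-! ### Bounds and termwise derivatives for the first two series. -/

/-- From `t⁶ / 6! ≤ e^t` at `t = 6 (k + 1)` and `6 < 2π`. The constant `6` leaves room for the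
losses in passing to `e^{2πK} - 1` and to `sinh²`. The sixth power lets a numerator grow like `K⁴`
and still leaves the majorant `1 / K²`. -/
theorem six_mul_pow_le_exp (k : ℕ) :
    6 * ((k : ℝ) + 1) ^ 6 ≤ Real.exp (2 * Real.pi * ((k : ℝ) + 1)) := by
  have hk : (0 : ℝ) ≤ k := k.cast_nonneg
  have h1 : (6 * ((k : ℝ) + 1)) ^ 6 / (Nat.factorial 6 : ℝ) ≤ Real.exp (6 * ((k : ℝ) + 1)) :=
    Real.pow_div_factorial_le_exp _ (by positivity) 6
  have h2 : Real.exp (6 * ((k : ℝ) + 1)) ≤ Real.exp (2 * Real.pi * ((k : ℝ) + 1)) := by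
    have := Real.pi_gt_three
    gcongr
    linarith
  have h3 : (6 * ((k : ℝ) + 1)) ^ 6 / (Nat.factorial 6 : ℝ) = 64.8 * ((k : ℝ) + 1) ^ 6 := by
    rw [show (Nat.factorial 6 : ℝ) = 720 by norm_num [Nat.factorial]]
    ring
  rw [h3] at h1
  have h4 : 0 ≤ ((k : ℝ) + 1) ^ 6 := by positivity
  linarith

theorem pow_le_exp_sub_one (k : ℕ) :
    ((k : ℝ) + 1) ^ 6 ≤ Real.exp (2 * Real.pi * ((k : ℝ) + 1)) - 1 := by
  have h1 := six_mul_pow_le_exp k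
  have h2 : (1 : ℝ) ≤ ((k : ℝ) + 1) ^ 6 := one_le_pow₀ (by linarith [(k.cast_nonneg : (0 : ℝ) ≤ k)])
  linarith

theorem pow_le_sinh_sq (k : ℕ) :
    ((k : ℝ) + 1) ^ 6 ≤ Real.sinh (Real.pi * ((k : ℝ) + 1)) ^ 2 := by
  have h1 := six_mul_pow_le_exp k
  have h2 : (1 : ℝ) ≤ ((k : ℝ) + 1) ^ 6 := one_le_pow₀ (by linarith [(k.cast_nonneg : (0 : ℝ) ≤ k)])
  have e : Real.exp (2 * Real.pi * ((k : ℝ) + 1)) = Real.exp (Real.pi * ((k : ℝ) + 1)) ^ 2 := by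
    rw [← Real.exp_nat_mul]
    ring_nf
  have e2 : Real.exp (Real.pi * ((k : ℝ) + 1)) * Real.exp (-(Real.pi * ((k : ℝ) + 1))) = 1 := by
    rw [← Real.exp_add, add_neg_cancel, Real.exp_zero]
  rw [e] at h1
  rw [Real.sinh_eq]
  nlinarith [sq_nonneg (Real.exp (-(Real.pi * ((k : ℝ) + 1))))]

theorem abs_log_le {t : ℝ} (ht : 0 < t) : |Real.log t| ≤ t + 1 / t := by
  have h1 := Real.log_le_sub_one_of_pos ht
  have h2 := Real.one_sub_inv_le_log_of_pos ht
  have h3 : 0 < t⁻¹ := inv_pos.2 ht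
  rw [one_div, abs_le]
  constructor <;> linarith

theorem poleTerm_succ (x : ℝ) (k : ℕ) : poleTerm x (k + 1) =
    2 * ((k : ℝ) + 1)
      / ((Real.exp (2 * Real.pi * ((k : ℝ) + 1)) - 1) * (((k : ℝ) + 1) ^ 2 - x ^ 2)) := by
  rw [poleTerm]
  push_cast
  rfl

theorem logTerm_succ (x : ℝ) (k : ℕ) : logTerm x (k + 1) =
    Real.log |((k : ℝ) + 1) ^ 4 - x ^ 4| / Real.sinh (Real.pi * ((k : ℝ) + 1)) ^ 2 := by
  rw [logTerm]
  push_cast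
  rfl

theorem abs_div_le_of_pow_six {C s d K : ℝ} (hK : 0 < K) (hs : |s| ≤ C * K ^ 4)
    (hd : K ^ 6 ≤ d) : |s / d| ≤ C * (1 / K ^ 2) := by
  have h6 : 0 < K ^ 6 := by positivity
  rw [abs_div, abs_of_pos (h6.trans_le hd)]
  calc |s| / d ≤ C * K ^ 4 / K ^ 6 := by
        have := (abs_nonneg s).trans hs
        gcongr
    _ = C * (1 / K ^ 2) := by field_simp

theorem abs_poleTerm_le {c y : ℝ} {k : ℕ} (hc : 0 < c)
    (h : c * ((k : ℝ) + 1) ^ 2 ≤ |((k : ℝ) + 1) ^ 2 - y ^ 2|) :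
    |poleTerm y (k + 1)| ≤ 2 / c * (1 / ((k : ℝ) + 1) ^ 2) := by
  rw [poleTerm_succ]
  set K := (k : ℝ) + 1 with hK
  have hK0 : 0 < K := by positivity
  have hK1 : 1 ≤ K := by rw [hK]; linarith [(k.cast_nonneg : (0 : ℝ) ≤ k)]
  rw [mul_comm (Real.exp _ - 1), ← div_div]
  refine abs_div_le_of_pow_six hK0 ?_ (pow_le_exp_sub_one k)
  rw [abs_div, abs_of_pos (by positivity : 0 < 2 * K)]
  calc 2 * K / |K ^ 2 - y ^ 2| ≤ 2 * K / (c * K ^ 2) := by gcongr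
    _ = 2 / c * (1 / K) := by field_simp
    _ ≤ 2 / c * K ^ 4 := by
      gcongr
      exact (div_le_one₀ hK0).2 hK1 |>.trans (one_le_pow₀ hK1)

theorem abs_pow_four_sub {c y K : ℝ} (h : c * K ^ 2 ≤ |K ^ 2 - y ^ 2|) :
    c * K ^ 4 ≤ |K ^ 4 - y ^ 4| := by
  have e : K ^ 4 - y ^ 4 = (K ^ 2 - y ^ 2) * (K ^ 2 + y ^ 2) := by ring
  rw [e, abs_mul, abs_of_nonneg (by positivity : 0 ≤ K ^ 2 + y ^ 2)]
  calc c * K ^ 4 = c * K ^ 2 * K ^ 2 := by ring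
    _ ≤ |K ^ 2 - y ^ 2| * (K ^ 2 + y ^ 2) := by
      gcongr
      linarith [sq_nonneg y]

/-- The argument of the logarithm lies between `c K⁴` and `(1 + B⁴) K⁴`, and `|log t| ≤ t + 1/t`
suffices against the denominator. -/
theorem abs_logTerm_le {c y B : ℝ} {k : ℕ} (hc : 0 < c) (hy : 0 < y) (hyB : y ≤ B)
    (h : c * ((k : ℝ) + 1) ^ 2 ≤ |((k : ℝ) + 1) ^ 2 - y ^ 2|) :
    |logTerm y (k + 1)| ≤ (1 + B ^ 4 + 1 / c) * (1 / ((k : ℝ) + 1) ^ 2) := by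
  rw [logTerm_succ]
  set K := (k : ℝ) + 1 with hK
  have hK0 : 0 < K := by positivity
  have hK1 : 1 ≤ K := by rw [hK]; linarith [(k.cast_nonneg : (0 : ℝ) ≤ k)]
  have hK4 : 1 ≤ K ^ 4 := one_le_pow₀ hK1
  refine abs_div_le_of_pow_six hK0 ?_ (pow_le_sinh_sq k)
  have h4 := abs_pow_four_sub h
  have hpos : 0 < |K ^ 4 - y ^ 4| := lt_of_lt_of_le (by positivity) h4
  have h5 : |K ^ 4 - y ^ 4| ≤ K ^ 4 + B ^ 4 * K ^ 4 := by
    have : y ^ 4 ≤ B ^ 4 := by gcongr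
    have h0 : 0 ≤ y ^ 4 := by positivity
    have h1 : B ^ 4 ≤ B ^ 4 * K ^ 4 := le_mul_of_one_le_right (h0.trans this) hK4
    rw [abs_le]
    constructor <;> linarith
  have h6 : 1 / |K ^ 4 - y ^ 4| ≤ 1 / c * K ^ 4 := by
    calc 1 / |K ^ 4 - y ^ 4| ≤ 1 / (c * K ^ 4) := by gcongr
      _ = 1 / c * (1 / K ^ 4) := by field_simp
      _ ≤ 1 / c * K ^ 4 := by
        gcongr
        exact ((div_le_one₀ (by positivity)).2 hK4).trans hK4
  calc _ ≤ _ := abs_log_le hpos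
    _ ≤ K ^ 4 + B ^ 4 * K ^ 4 + 1 / c * K ^ 4 := add_le_add h5 h6
    _ = _ := by ring

theorem summable_poleTerm {m : ℕ} {x : ℝ} (hx : x ∈ Ioo (m : ℝ) (m + 1)) :
    Summable fun k : ℕ => poleTerm x (k + 1) := by
  obtain ⟨a, b, c, -, -, -, hxab, hc, h⟩ := exists_gap hx
  exact Summable.of_norm_bounded (summable_one_div_nat_add_one_sq.mul_left _)
    fun k => abs_poleTerm_le hc (h x hxab k)

theorem summable_logTerm {m : ℕ} {x : ℝ} (hx : x ∈ Ioo (m : ℝ) (m + 1)) :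
    Summable fun k : ℕ => logTerm x (k + 1) := by
  obtain ⟨a, b, c, -, -, -, hxab, hc, h⟩ := exists_gap hx
  exact Summable.of_norm_bounded (summable_one_div_nat_add_one_sq.mul_left _)
    fun k => abs_logTerm_le hc (pos_of_mem_Ioo_nat hx) le_rfl (h x hxab k)

theorem hasDerivAt_tsum_poleTerm {m : ℕ} {x : ℝ} (hx : x ∈ Ioo (m : ℝ) (m + 1)) :
    Summable (fun k : ℕ => 4 * ((k : ℝ) + 1) * x
      / ((Real.exp (2 * Real.pi * ((k : ℝ) + 1)) - 1) * (((k : ℝ) + 1) ^ 2 - x ^ 2) ^ 2)) ∧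
    HasDerivAt (fun y => ∑' k : ℕ, poleTerm y (k + 1))
      (∑' k : ℕ, 4 * ((k : ℝ) + 1) * x
        / ((Real.exp (2 * Real.pi * ((k : ℝ) + 1)) - 1) * (((k : ℝ) + 1) ^ 2 - x ^ 2) ^ 2)) x := by
  obtain ⟨a, b, c, ha, hma, hb, hxab, hc, hgap⟩ := exists_gap hx
  have hbd : ∀ k : ℕ, ∀ y ∈ Ioo a b, |4 * ((k : ℝ) + 1) * y
      / ((Real.exp (2 * Real.pi * ((k : ℝ) + 1)) - 1) * (((k : ℝ) + 1) ^ 2 - y ^ 2) ^ 2)|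
      ≤ 4 * b / c ^ 2 * (1 / ((k : ℝ) + 1) ^ 2) := by
    intro k y hy
    have hg := hgap y hy k
    have hy0 : 0 < y := ha.trans hy.1
    set K := (k : ℝ) + 1 with hK
    have hK0 : 0 < K := by positivity
    have hK1 : 1 ≤ K := by rw [hK]; linarith [(k.cast_nonneg : (0 : ℝ) ≤ k)]
    rw [mul_comm (Real.exp _ - 1), ← div_div]
    refine abs_div_le_of_pow_six hK0 ?_ (pow_le_exp_sub_one k)
    rw [← sq_abs (K ^ 2 - y ^ 2), abs_of_nonneg (by positivity)]
    calc 4 * K * y / |K ^ 2 - y ^ 2| ^ 2 ≤ 4 * K * b / (c * K ^ 2) ^ 2 := by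
          have := hy.2.le
          have := hy0.trans hy.2
          gcongr
      _ = 4 * b / c ^ 2 * (1 / K ^ 3) := by field_simp
      _ ≤ 4 * b / c ^ 2 * K ^ 4 := by
        have : 0 < b := hy0.trans hy.2
        gcongr
        exact ((div_le_one₀ (by positivity)).2 (one_le_pow₀ hK1)).trans (one_le_pow₀ hK1)
  have hus := summable_one_div_nat_add_one_sq.mul_left (4 * b / c ^ 2)
  refine ⟨Summable.of_norm_bounded hus fun k => hbd k x hxab, ?_⟩
  refine hasDerivAt_tsum_Ioo (g := fun (k : ℕ) (y : ℝ) => poleTerm y (k + 1))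
    (g' := fun (k : ℕ) (y : ℝ) => 4 * ((k : ℝ) + 1) * y
      / ((Real.exp (2 * Real.pi * ((k : ℝ) + 1)) - 1) * (((k : ℝ) + 1) ^ 2 - y ^ 2) ^ 2))
    hxab hus ?_ hbd (summable_poleTerm hx)
  intro k y hy
  have hy' : y ∈ Ioo (m : ℝ) (m + 1) := ⟨lt_of_le_of_lt hma hy.1, lt_of_lt_of_le hy.2 hb⟩
  have h0 := sq_sub_sq_ne_zero hy' k
  have hE : Real.exp (2 * Real.pi * ((k : ℝ) + 1)) - 1 ≠ 0 :=
    (exp_two_pi_mul_sub_one_pos (by positivity)).ne'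
  have h := ((((hasDerivAt_id y).pow 2).const_sub (((k : ℝ) + 1) ^ 2)).const_mul
    (Real.exp (2 * Real.pi * ((k : ℝ) + 1)) - 1)).inv (mul_ne_zero hE h0)
  have h2 := h.const_mul (2 * ((k : ℝ) + 1))
  simp only [poleTerm_succ]
  convert! h2 using 1
  simp only [id, Pi.pow_apply]
  generalize Real.exp (2 * Real.pi * ((k : ℝ) + 1)) - 1 = E at *
  field_simp
  ring

theorem hasDerivAt_tsum_logTerm {m : ℕ} {x : ℝ} (hx : x ∈ Ioo (m : ℝ) (m + 1)) :
    Summable (fun k : ℕ => 4 * x ^ 3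
      / ((((k : ℝ) + 1) ^ 4 - x ^ 4) * Real.sinh (Real.pi * ((k : ℝ) + 1)) ^ 2)) ∧
    HasDerivAt (fun y => ∑' k : ℕ, logTerm y (k + 1))
      (∑' k : ℕ, -(4 * x ^ 3
        / ((((k : ℝ) + 1) ^ 4 - x ^ 4) * Real.sinh (Real.pi * ((k : ℝ) + 1)) ^ 2))) x := by
  obtain ⟨a, b, c, ha, hma, hb, hxab, hc, hgap⟩ := exists_gap hx
  have hbd : ∀ k : ℕ, ∀ y ∈ Ioo a b, |4 * y ^ 3
      / ((((k : ℝ) + 1) ^ 4 - y ^ 4) * Real.sinh (Real.pi * ((k : ℝ) + 1)) ^ 2)|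
      ≤ 4 * b ^ 3 / c * (1 / ((k : ℝ) + 1) ^ 2) := by
    intro k y hy
    have hg := abs_pow_four_sub (hgap y hy k)
    have hy0 : 0 < y := ha.trans hy.1
    set K := (k : ℝ) + 1 with hK
    have hK0 : 0 < K := by positivity
    have hK1 : 1 ≤ K := by rw [hK]; linarith [(k.cast_nonneg : (0 : ℝ) ≤ k)]
    rw [← div_div]
    refine abs_div_le_of_pow_six hK0 ?_ (pow_le_sinh_sq k)
    rw [abs_div, abs_of_pos (by positivity : 0 < 4 * y ^ 3)]
    calc 4 * y ^ 3 / |K ^ 4 - y ^ 4| ≤ 4 * b ^ 3 / (c * K ^ 4) := by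
          have := hy.2.le
          have := hy0.trans hy.2
          gcongr
      _ = 4 * b ^ 3 / c * (1 / K ^ 4) := by field_simp
      _ ≤ 4 * b ^ 3 / c * K ^ 4 := by
        have : 0 < b := hy0.trans hy.2
        gcongr
        exact ((div_le_one₀ (by positivity)).2 (one_le_pow₀ hK1)).trans (one_le_pow₀ hK1)
  have hus := summable_one_div_nat_add_one_sq.mul_left (4 * b ^ 3 / c)
  refine ⟨Summable.of_norm_bounded hus fun k => hbd k x hxab, ?_⟩
  refine hasDerivAt_tsum_Ioo (g := fun (k : ℕ) (y : ℝ) => logTerm y (k + 1))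
    (g' := fun (k : ℕ) (y : ℝ) => -(4 * y ^ 3
      / ((((k : ℝ) + 1) ^ 4 - y ^ 4) * Real.sinh (Real.pi * ((k : ℝ) + 1)) ^ 2)))
    hxab hus ?_ (fun k y hy => by rw [abs_neg]; exact hbd k y hy) (summable_logTerm hx)
  intro k y hy
  have h0 : ((k : ℝ) + 1) ^ 4 - y ^ 4 ≠ 0 := by
    refine abs_pos.1 (lt_of_lt_of_le ?_ (abs_pow_four_sub (hgap y hy k)))
    positivity
  have h := ((((hasDerivAt_id y).pow 4).const_sub (((k : ℝ) + 1) ^ 4)).log h0).div_const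
    (Real.sinh (Real.pi * ((k : ℝ) + 1)) ^ 2)
  simp only [logTerm_succ, Real.log_abs]
  convert! h using 1
  simp [neg_div, div_div]

/-! ### The derivative of the right-hand side. -/

theorem one_div_four_sinh_sq_eq {x : ℝ} (hx : 0 < x) :
    1 / (4 * Real.sinh (Real.pi * x) ^ 2)
      = Real.exp (2 * Real.pi * x) / (Real.exp (2 * Real.pi * x) - 1) ^ 2 := by
  have h := (exp_two_pi_mul_sub_one_pos hx).ne'
  have h2 := (Real.exp_pos (2 * Real.pi * x)).ne'
  rw [one_div_four_sinh_sq hx, Real.exp_neg]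
  generalize Real.exp (2 * Real.pi * x) = E at *
  field_simp

/-- Groups the logarithmic term with the double series, the combination whose derivative is known.
-/
theorem rhs_eq (x : ℝ) : rhs x =
    (Real.pi / 3 * Real.log x + 1 / (2 * x) - 1 / (4 * Real.pi * x ^ 2))
    + Real.pi * Real.cot (Real.pi * x) / (Real.exp (2 * Real.pi * x) - 1)
    + (∑' k : ℕ, poleTerm x (k + 1)) - Real.pi / 2 * (∑' k : ℕ, logTerm x (k + 1))
    + 2 * Real.pi * (Real.log |2 * Real.sin (Real.pi * x)| / (4 * Real.sinh (Real.pi * x) ^ 2)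
        - ∑' k : ℕ, doubleTerm x (k + 1)) := by
  rw [rhs, elementaryPart]
  ring

theorem hasDerivAt_rhs {m : ℕ} {x : ℝ} (hx : x ∈ Ioo (m : ℝ) (m + 1)) :
    HasDerivAt rhs (∑' n : ℕ, 1 / (x + n + 1) ^ 2) x := by
  have hx0 := pos_of_mem_Ioo_nat hx
  have hsin := sin_pi_mul_ne_zero_of_mem hx
  have hE := (exp_two_pi_mul_sub_one_pos hx0).ne'
  have hpi := Real.pi_ne_zero
  have d1 : HasDerivAt (fun y : ℝ => Real.pi / 3 * Real.log y + 1 / (2 * y)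
      - 1 / (4 * Real.pi * y ^ 2))
      (Real.pi / (3 * x) - 1 / (2 * x ^ 2) + 1 / (2 * Real.pi * x ^ 3)) x := by
    have h := (((Real.hasDerivAt_log hx0.ne').const_mul (Real.pi / 3)).add
      ((hasDerivAt_inv hx0.ne').const_mul (1 / 2))).sub
      ((((hasDerivAt_id x).pow 2).inv (pow_ne_zero 2 hx0.ne')).const_mul (1 / (4 * Real.pi)))
    convert! h using 1
    · ext y
      simp
      ring
    · simp
      field_simp
      ring
  have d2 : HasDerivAt (fun y : ℝ => Real.pi * Real.cot (Real.pi * y)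
      / (Real.exp (2 * Real.pi * y) - 1))
      (-(Real.pi ^ 2 / Real.sin (Real.pi * x) ^ 2 / (Real.exp (2 * Real.pi * x) - 1))
        - 2 * Real.pi * (Real.pi * Real.cot (Real.pi * x) / (4 * Real.sinh (Real.pi * x) ^ 2)))
      x := by
    have h := ((hasDerivAt_cot_pi_mul hsin).const_mul Real.pi).div
      ((((hasDerivAt_id x).const_mul (2 * Real.pi)).exp).sub_const 1) hE
    convert! h using 1
    rw [div_eq_mul_one_div (Real.pi * Real.cot (Real.pi * x)), one_div_four_sinh_sq_eq hx0]
    simp only [id]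
    generalize Real.exp (2 * Real.pi * x) = E at *
    field_simp
  obtain ⟨s3, d3⟩ := hasDerivAt_tsum_poleTerm hx
  obtain ⟨s4, d4⟩ := hasDerivAt_tsum_logTerm hx
  have d5 := hasDerivAt_log_sub_doubleSeries hx
  have h := (((d1.add d2).add d3).sub (d4.const_mul (Real.pi / 2))).add (d5.const_mul (2 * Real.pi))
  have hV := hasSum_deriv_series hx
  have hV2 := s3.hasSum.add (s4.hasSum.mul_left (Real.pi / 2))
  -- Up to the factor `π / 2` on the second, the differentiated pole and logarithm series add up to
  -- the series already summed.
  have e := hV.unique (hV2.congr_fun fun k => by ring)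
  convert! h using 1
  · ext y
    exact rhs_eq y
  · rw [tsum_neg]
    linear_combination e

theorem rhs_sub_psi_const {m : ℕ} {x y : ℝ} (hx : x ∈ Ioo (m : ℝ) (m + 1))
    (hy : y ∈ Ioo (m : ℝ) (m + 1)) : rhs x - psi (x + 1) = rhs y - psi (y + 1) := by
  have hd : ∀ z ∈ Ioo (m : ℝ) (m + 1), HasDerivAt (fun z => rhs z - psi (z + 1)) 0 z := by
    intro z hz
    have h := (hasDerivAt_rhs hz).sub (hasDerivAt_psi_add_one (pos_of_mem_Ioo_nat hz))
    rwa [sub_self] at h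
  exact isOpen_Ioo.is_const_of_deriv_eq_zero isPreconnected_Ioo
    (fun z hz => (hd z hz).differentiableAt.differentiableWithinAt)
    (fun z hz => (hd z hz).deriv) hx hy

/-! ### Gluing across an integer. -/

theorem half_le_abs_sub {p k : ℕ} {y : ℝ} (hk : k ≠ p)
    (hy : y ∈ Ioo ((p : ℝ) + 1 / 2) (p + 3 / 2)) : 1 / 2 ≤ |((k : ℝ) + 1) - y| := by
  obtain ⟨h1, h2⟩ := hy
  rcases lt_or_gt_of_ne hk with h | h
  · have : (k : ℝ) + 1 ≤ p := by exact_mod_cast h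
    rw [abs_of_neg (by linarith)]
    linarith
  · have : (p : ℝ) + 1 ≤ k := by exact_mod_cast h
    rw [abs_of_pos (by linarith)]
    linarith

/-- Near `p + 1` only the term of index `p` is singular; the others obey the lower bound with `δ =
1/2` and `B = p + 3/2`. -/
theorem gap_of_ne {p k : ℕ} {y : ℝ} (hk : k ≠ p) (hy : y ∈ Ioo ((p : ℝ) + 1 / 2) (p + 3 / 2)) :
    1 / 2 / (1 / 2 + ((p : ℝ) + 3 / 2)) * ((k : ℝ) + 1) ^ 2 ≤ |((k : ℝ) + 1) ^ 2 - y ^ 2| := by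
  have hy0 : 0 < y := lt_trans (by positivity) hy.1
  exact mul_sq_le_abs_sq_sub_sq (by norm_num) hy0 hy.2.le (half_le_abs_sub hk hy)

theorem continuousAt_tsum_poleTerm_ne (p : ℕ) :
    ContinuousAt (fun y => ∑' k : ℕ, if k = p then 0 else poleTerm y (k + 1)) ((p : ℝ) + 1) := by
  set c := 1 / 2 / (1 / 2 + ((p : ℝ) + 3 / 2)) with hc
  have hc0 : 0 < c := by positivity
  have h : ContinuousOn (fun y => ∑' k : ℕ, if k = p then 0 else poleTerm y (k + 1))
      (Ioo ((p : ℝ) + 1 / 2) (p + 3 / 2)) := by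
    refine continuousOn_tsum (fun k => ?_)
      (summable_one_div_nat_add_one_sq.mul_left (2 / c)) fun k y hy => ?_
    · by_cases hk : k = p
      · simp only [if_pos hk]
        exact continuousOn_const
      · simp only [if_neg hk, poleTerm_succ]
        refine ContinuousOn.div continuousOn_const (by fun_prop) fun y hy => mul_ne_zero ?_ ?_
        · exact (exp_two_pi_mul_sub_one_pos (by positivity)).ne'
        · exact abs_pos.1 (lt_of_lt_of_le (by positivity) (gap_of_ne hk hy))
    · by_cases hk : k = p
      · simp only [if_pos hk, norm_zero]
        positivity
      · simp only [if_neg hk]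
        exact abs_poleTerm_le hc0 (gap_of_ne hk hy)
  exact h.continuousAt (Ioo_mem_nhds (by linarith) (by linarith))

theorem continuousAt_tsum_logTerm_ne (p : ℕ) :
    ContinuousAt (fun y => ∑' k : ℕ, if k = p then 0 else logTerm y (k + 1)) ((p : ℝ) + 1) := by
  set c := 1 / 2 / (1 / 2 + ((p : ℝ) + 3 / 2)) with hc
  have hc0 : 0 < c := by positivity
  have h : ContinuousOn (fun y => ∑' k : ℕ, if k = p then 0 else logTerm y (k + 1))
      (Ioo ((p : ℝ) + 1 / 2) (p + 3 / 2)) := by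
    refine continuousOn_tsum (fun k => ?_) (summable_one_div_nat_add_one_sq.mul_left
      (1 + ((p : ℝ) + 3 / 2) ^ 4 + 1 / c)) fun k y hy => ?_
    · by_cases hk : k = p
      · simp only [if_pos hk]
        exact continuousOn_const
      · simp only [if_neg hk, logTerm_succ, Real.log_abs]
        refine (ContinuousOn.log (by fun_prop) fun y hy => ?_).div_const _
        exact abs_pos.1 (lt_of_lt_of_le (by positivity) (abs_pow_four_sub (gap_of_ne hk hy)))
    · by_cases hk : k = p
      · simp only [if_pos hk, norm_zero]
        positivity
      · simp only [if_neg hk]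
        exact abs_logTerm_le hc0 (lt_trans (by positivity) hy.1) hy.2.le (gap_of_ne hk hy)
  exact h.continuousAt (Ioo_mem_nhds (by linarith) (by linarith))

/-- The part of `rhs` that is continuous at `p + 1`. -/
noncomputable def regularPart (p : ℕ) (y : ℝ) : ℝ :=
  (Real.pi / 3 * Real.log y + 1 / (2 * y) - 1 / (4 * Real.pi * y ^ 2))
    + 1 / (Real.exp (2 * Real.pi * ((p : ℝ) + 1)) - 1) / ((p : ℝ) + 1 + y)
    - Real.pi / 2 * (Real.log (((p : ℝ) + 1 + y) * (((p : ℝ) + 1) ^ 2 + y ^ 2))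
        / Real.sinh (Real.pi * ((p : ℝ) + 1)) ^ 2)
    + (∑' k : ℕ, if k = p then 0 else poleTerm y (k + 1))
    - Real.pi / 2 * (∑' k : ℕ, if k = p then 0 else logTerm y (k + 1))
    - 2 * Real.pi * ∑' k : ℕ, doubleTerm y (k + 1)

theorem continuousAt_regularPart (p : ℕ) : ContinuousAt (regularPart p) ((p : ℝ) + 1) := by
  have h1 := continuousAt_tsum_poleTerm_ne p
  have h2 := continuousAt_tsum_logTerm_ne p
  have hp : (0 : ℝ) < (p : ℝ) + 1 := by positivity
  have h3 := continuousAt_tsum_doubleTerm hp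
  have h4 : ContinuousAt (fun y : ℝ =>
      Real.pi / 3 * Real.log y + 1 / (2 * y) - 1 / (4 * Real.pi * y ^ 2)) ((p : ℝ) + 1) := by
    have hpi := Real.pi_pos
    exact (((Real.continuousAt_log hp.ne').const_mul _).add
      (continuousAt_const.div (by fun_prop) (by positivity))).sub
      (continuousAt_const.div (by fun_prop) (by positivity))
  have h5 : ContinuousAt (fun y : ℝ => 1 / (Real.exp (2 * Real.pi * ((p : ℝ) + 1)) - 1)
      / ((p : ℝ) + 1 + y)) ((p : ℝ) + 1) :=
    continuousAt_const.div (by fun_prop) (by positivity)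
  have h6 : ContinuousAt (fun y : ℝ =>
      Real.log (((p : ℝ) + 1 + y) * (((p : ℝ) + 1) ^ 2 + y ^ 2))
        / Real.sinh (Real.pi * ((p : ℝ) + 1)) ^ 2) ((p : ℝ) + 1) :=
    (ContinuousAt.log (by fun_prop) (by positivity)).div_const _
  exact ((((h4.add h5).sub (h6.const_mul _)).add h1).sub (h2.const_mul _)).sub (h3.const_mul _)

/-- Isolates what is singular at `p + 1`: the cotangent and `log |2 sin|` terms, the simple pole `1
/ (p + 1 - y)`, and the factor `p + 1 - y` of the argument of the `p`-th logarithm. -/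
theorem rhs_eq_regularPart_add {p m : ℕ} {y : ℝ} (hy : y ∈ Ioo (m : ℝ) (m + 1)) :
    rhs y = regularPart p y
      + Real.pi * Real.cot (Real.pi * y) * (1 / (Real.exp (2 * Real.pi * y) - 1))
      + Real.log |2 * Real.sin (Real.pi * y)| * (Real.pi / (2 * Real.sinh (Real.pi * y) ^ 2))
      + 1 / (Real.exp (2 * Real.pi * ((p : ℝ) + 1)) - 1) / ((p : ℝ) + 1 - y)
      - Real.pi / 2 * (Real.log |(p : ℝ) + 1 - y| / Real.sinh (Real.pi * ((p : ℝ) + 1)) ^ 2) := by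
  have hy0 := pos_of_mem_Ioo_nat hy
  have e1 := (summable_poleTerm hy).tsum_eq_add_tsum_ite p
  have e2 := (summable_logTerm hy).tsum_eq_add_tsum_ite p
  have h0 := sq_sub_sq_ne_zero hy p
  have hE : Real.exp (2 * Real.pi * ((p : ℝ) + 1)) - 1 ≠ 0 :=
    (exp_two_pi_mul_sub_one_pos (by positivity)).ne'
  have hp : (0 : ℝ) < (p : ℝ) + 1 := by positivity
  have hplus : (p : ℝ) + 1 + y ≠ 0 := by positivity
  have hminus : (p : ℝ) + 1 - y ≠ 0 := by
    intro h
    apply h0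
    linear_combination ((p : ℝ) + 1 + y) * h
  have e3 : poleTerm y (p + 1) = 1 / (Real.exp (2 * Real.pi * ((p : ℝ) + 1)) - 1)
      / ((p : ℝ) + 1 + y) + 1 / (Real.exp (2 * Real.pi * ((p : ℝ) + 1)) - 1)
      / ((p : ℝ) + 1 - y) := by
    rw [poleTerm_succ, show ((p : ℝ) + 1) ^ 2 - y ^ 2 = ((p : ℝ) + 1 + y) * ((p : ℝ) + 1 - y) by
      ring]
    generalize Real.exp (2 * Real.pi * ((p : ℝ) + 1)) - 1 = E at *
    field_simp
    ring
  have e4 : logTerm y (p + 1) = Real.log |(p : ℝ) + 1 - y|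
        / Real.sinh (Real.pi * ((p : ℝ) + 1)) ^ 2
      + Real.log (((p : ℝ) + 1 + y) * (((p : ℝ) + 1) ^ 2 + y ^ 2))
        / Real.sinh (Real.pi * ((p : ℝ) + 1)) ^ 2 := by
    rw [logTerm_succ, Real.log_abs, Real.log_abs, ← add_div, ← Real.log_mul hminus (by positivity)]
    congr 2
    ring
  rw [rhs_eq, regularPart, e1, e2, e3, e4]
  ring

/-- The difference is `-(sin t - t cos t) / (t sin t)`, with numerator between `0` and `t³ / 2` and
`sin t ≥ t / 2`. -/
theorem abs_cot_sub_inv_le {t : ℝ} (h0 : 0 < t) (h1 : t ≤ 1) : |Real.cot t - 1 / t| ≤ t := by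
  have hs := Real.sin_gt_sub_cube h0
  have hc := Real.one_sub_sq_div_two_le_cos (x := t)
  have hcos : 0 < Real.cos t := lt_of_lt_of_le (by nlinarith) hc
  have hle : t * Real.cos t ≤ Real.sin t := by
    have h := Real.lt_tan h0 (by linarith [Real.pi_gt_three])
    rw [Real.tan_eq_sin_div_cos, lt_div_iff₀ hcos] at h
    exact h.le
  have hsin : t / 2 ≤ Real.sin t := by nlinarith [sq_nonneg t]
  have hsin0 : 0 < Real.sin t := by linarith
  have hsin1 : Real.sin t ≤ t := Real.sin_le h0.le
  have e : Real.cot t - 1 / t = -((Real.sin t - t * Real.cos t) / (t * Real.sin t)) := by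
    rw [Real.cot_eq_cos_div_sin]
    field_simp
    ring
  rw [e, abs_neg, abs_of_nonneg (div_nonneg (by linarith) (by positivity)),
    div_le_iff₀ (by positivity)]
  nlinarith [mul_le_mul_of_nonneg_left hc h0.le, mul_le_mul_of_nonneg_left hsin (sq_nonneg t)]

theorem tendsto_cot_sub_inv :
    Tendsto (fun ε : ℝ => Real.pi * Real.cot (Real.pi * ε) - 1 / ε) (𝓝[>] 0) (𝓝 0) := by
  have h0 : Tendsto (fun ε : ℝ => Real.pi * (Real.pi * ε)) (𝓝[>] 0) (𝓝 0) := by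
    have : Tendsto (fun ε : ℝ => Real.pi * (Real.pi * ε)) (𝓝 0) (𝓝 (Real.pi * (Real.pi * 0))) :=
      Continuous.tendsto (by fun_prop) 0
    simpa using this.mono_left nhdsWithin_le_nhds
  refine squeeze_zero_norm' ?_ h0
  have hpi := Real.pi_pos
  filter_upwards [Ioo_mem_nhdsGT (by positivity : (0 : ℝ) < 1 / Real.pi)] with ε hε
  have h1 : Real.pi * ε ≤ 1 := by
    have := (lt_div_iff₀ hpi).1 hε.2
    linarith
  have h2 := abs_cot_sub_inv_le (mul_pos hpi hε.1) h1
  have hε0 := hε.1.ne'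
  have e : Real.pi * Real.cot (Real.pi * ε) - 1 / ε
      = Real.pi * (Real.cot (Real.pi * ε) - 1 / (Real.pi * ε)) := by
    field_simp
  rw [e, Real.norm_eq_abs, abs_mul, abs_of_pos hpi]
  gcongr

theorem tendsto_mul_log_two_sin :
    Tendsto (fun ε : ℝ => ε * Real.log |2 * Real.sin (Real.pi * ε)|) (𝓝[>] 0) (𝓝 0) := by
  have hd : HasDerivAt (fun ε : ℝ => 2 * Real.sin (Real.pi * ε)) (2 * Real.pi) 0 := by
    have h := (((hasDerivAt_id (0 : ℝ)).const_mul Real.pi).sin).const_mul 2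
    simpa using h
  have h1 := hd.tendsto_slope_zero_right
  have h2 : Tendsto (fun ε : ℝ => Real.log (ε⁻¹ * (2 * Real.sin (Real.pi * ε)))) (𝓝[>] 0)
      (𝓝 (Real.log (2 * Real.pi))) := by
    have := (Real.continuousAt_log Real.two_pi_pos.ne').tendsto.comp h1
    simpa [Function.comp_def] using this
  have hid : Tendsto (fun ε : ℝ => ε) (𝓝[>] 0) (𝓝 0) := tendsto_id.mono_left nhdsWithin_le_nhds
  have h3 : Tendsto (fun ε : ℝ => ε * Real.log ε) (𝓝[>] 0) (𝓝 0) := by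
    have := (Real.continuous_mul_log.tendsto 0).mono_left (nhdsWithin_le_nhds (s := Ioi 0))
    simpa using this
  have h4 := (hid.mul h2).add h3
  rw [zero_mul, zero_add] at h4
  -- Here `log (2 sin πε)` is split as `log (ε⁻¹ · 2 sin πε) + log ε`; the first part has a limit
  -- and `ε log ε` tends to `0`.
  refine h4.congr' ?_
  filter_upwards [Ioo_mem_nhdsGT (zero_lt_one (α := ℝ))] with ε hε
  have hsin : 0 < Real.sin (Real.pi * ε) :=
    Real.sin_pos_of_pos_of_lt_pi (mul_pos Real.pi_pos hε.1) (by nlinarith [Real.pi_pos, hε.2])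
  rw [Real.log_abs, Real.log_mul (inv_ne_zero hε.1.ne') (by positivity), Real.log_inv]
  ring

theorem cot_add_nat_mul_pi (t : ℝ) (n : ℕ) : Real.cot (n * Real.pi + t) = Real.cot t := by
  induction n with
  | zero => simp
  | succ n ih =>
    rw [← ih, Real.cot_eq_cos_div_sin, Real.cot_eq_cos_div_sin,
      show ((n + 1 : ℕ) : ℝ) * Real.pi + t = (n * Real.pi + t) + Real.pi by push_cast; ring,
      Real.cos_add_pi, Real.sin_add_pi, neg_div_neg_eq]

theorem abs_sin_add_nat_mul_pi (t : ℝ) (n : ℕ) :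
    |Real.sin (n * Real.pi + t)| = |Real.sin t| := by
  induction n with
  | zero => simp
  | succ n ih =>
    rw [← ih, show ((n + 1 : ℕ) : ℝ) * Real.pi + t = (n * Real.pi + t) + Real.pi by push_cast; ring,
      Real.sin_add_pi, abs_neg]

theorem differentiableAt_planck {x : ℝ} (hx : 0 < x) :
    DifferentiableAt ℝ (fun y => 1 / (Real.exp (2 * Real.pi * y) - 1)) x :=
  (differentiableAt_const _).div (by fun_prop) (exp_two_pi_mul_sub_one_pos hx).ne'

theorem differentiableAt_csch_sq {x : ℝ} (hx : 0 < x) :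
    DifferentiableAt ℝ (fun y => Real.pi / (2 * Real.sinh (Real.pi * y) ^ 2)) x := by
  have := sinh_pi_mul_pos hx
  exact (differentiableAt_const _).div (by fun_prop) (by positivity)

/-- A symmetric difference suffices, because constancy on either side does the rest. In it `log |ε|`
drops out exactly. With `q = 1/(e^{2πy} - 1)` and `s = π/(2 sinh² πy)`, there remain `π cot(πε)
(q(M+ε) + q(M-ε)) - 2 q(M)/ε` and `log |2 sin πε| (s(M+ε) - s(M-ε))`. -/
theorem tendsto_rhs_add_sub_rhs_sub (p : ℕ) :
    Tendsto (fun ε : ℝ => rhs ((p : ℝ) + 1 + ε) - rhs ((p : ℝ) + 1 - ε)) (𝓝[>] 0) (𝓝 0) := by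
  set M := (p : ℝ) + 1 with hM
  have hM0 : 0 < M := by positivity
  set q : ℝ → ℝ := fun y => 1 / (Real.exp (2 * Real.pi * y) - 1) with hq
  set s : ℝ → ℝ := fun y => Real.pi / (2 * Real.sinh (Real.pi * y) ^ 2) with hs
  have hplus : HasDerivAt (fun t : ℝ => M + t) 1 0 := (hasDerivAt_id 0).const_add M
  have hminus : HasDerivAt (fun t : ℝ => M - t) (-1) 0 := (hasDerivAt_id 0).const_sub M
  have hder : ∀ f : ℝ → ℝ, DifferentiableAt ℝ f M →
      HasDerivAt (fun t => f (M + t)) (deriv f M) 0 ∧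
      HasDerivAt (fun t => f (M - t)) (-deriv f M) 0 := by
    intro f hf
    constructor
    · have h : HasDerivAt f (deriv f M) (M + 0) := by rw [add_zero]; exact hf.hasDerivAt
      simpa [Function.comp_def] using h.comp 0 hplus
    · have h : HasDerivAt f (deriv f M) (M - 0) := by rw [sub_zero]; exact hf.hasDerivAt
      simpa [Function.comp_def] using h.comp 0 hminus
  obtain ⟨hq1, hq2⟩ := hder q (differentiableAt_planck hM0)
  obtain ⟨hs1, hs2⟩ := hder s (differentiableAt_csch_sq hM0)
  have tq : Tendsto (fun ε : ℝ => ε⁻¹ * (q (M + ε) + q (M - ε) - 2 * q M)) (𝓝[>] 0) (𝓝 0) := by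
    have h := (hq1.add hq2).tendsto_slope_zero_right
    simp only [Pi.add_apply, zero_add, add_zero, sub_zero, smul_eq_mul, add_neg_cancel] at h
    refine h.congr fun ε => ?_
    ring
  have ts : Tendsto (fun ε : ℝ => ε⁻¹ * (s (M + ε) - s (M - ε))) (𝓝[>] 0)
      (𝓝 (deriv s M - -deriv s M)) := by
    have h := (hs1.sub hs2).tendsto_slope_zero_right
    simpa using h
  have hid : Tendsto (fun ε : ℝ => ε) (𝓝[>] 0) (𝓝 0) := tendsto_id.mono_left nhdsWithin_le_nhds
  have tΦ : Tendsto (fun ε : ℝ => regularPart p (M + ε) - regularPart p (M - ε)) (𝓝[>] 0)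
      (𝓝 0) := by
    have c := continuousAt_regularPart p
    have h1 : Tendsto (fun ε : ℝ => M + ε) (𝓝[>] 0) (𝓝 M) := by simpa using hid.const_add M
    have h2 : Tendsto (fun ε : ℝ => M - ε) (𝓝[>] 0) (𝓝 M) := by simpa using hid.const_sub M
    have h := (c.tendsto.comp h1).sub (c.tendsto.comp h2)
    simpa [Function.comp_def] using h
  have tc := tendsto_cot_sub_inv
  -- The first of these is `(1 + ε c) ε⁻¹ (q(M+ε) + q(M-ε) - 2 q(M)) + 2 q(M) c` with `c = π cot(πε)
  -- - 1/ε → 0`; the second is `ε log |2 sin πε|` times a bounded difference quotient.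
  have tot := ((tΦ.add (((hid.mul tc).const_add 1).mul tq)).add (tc.const_mul (2 * q M))).add
    (tendsto_mul_log_two_sin.mul ts)
  simp only [zero_mul, mul_zero, add_zero] at tot
  refine tot.congr' ?_
  filter_upwards [Ioo_mem_nhdsGT (zero_lt_one (α := ℝ))] with ε hε
  obtain ⟨hε0, hε1⟩ := hε
  have hy1 : M + ε ∈ Ioo ((p + 1 : ℕ) : ℝ) ((p + 1 : ℕ) + 1) := by
    push_cast
    exact ⟨by linarith, by linarith⟩
  have hy2 : M - ε ∈ Ioo (p : ℝ) (p + 1) := ⟨by linarith, by linarith⟩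
  rw [rhs_eq_regularPart_add (p := p) hy1, rhs_eq_regularPart_add (p := p) hy2]
  have c1 : Real.cot (Real.pi * (M + ε)) = Real.cot (Real.pi * ε) := by
    rw [← cot_add_nat_mul_pi (Real.pi * ε) (p + 1)]
    congr 1
    push_cast
    ring
  have c2 : Real.cot (Real.pi * (M - ε)) = -Real.cot (Real.pi * ε) := by
    have : Real.cot (-(Real.pi * ε)) = -Real.cot (Real.pi * ε) := by
      rw [Real.cot_eq_cos_div_sin, Real.cot_eq_cos_div_sin, Real.cos_neg, Real.sin_neg, div_neg]
    rw [← this, ← cot_add_nat_mul_pi (-(Real.pi * ε)) (p + 1)]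
    congr 1
    push_cast
    ring
  have l1 : |2 * Real.sin (Real.pi * (M + ε))| = |2 * Real.sin (Real.pi * ε)| := by
    rw [abs_mul, abs_mul, ← abs_sin_add_nat_mul_pi (Real.pi * ε) (p + 1)]
    congr 3
    push_cast
    ring
  have l2 : |2 * Real.sin (Real.pi * (M - ε))| = |2 * Real.sin (Real.pi * ε)| := by
    rw [abs_mul, abs_mul, ← abs_neg (Real.sin (Real.pi * ε)), ← Real.sin_neg,
      ← abs_sin_add_nat_mul_pi (-(Real.pi * ε)) (p + 1)]
    congr 3
    push_cast
    ring
  rw [c1, c2, l1, l2, ← hM]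
  have m1 : M - (M + ε) = -ε := by ring
  have m2 : M - (M - ε) = ε := by ring
  rw [m1, m2, abs_neg]
  change _ = regularPart p (M + ε) + Real.pi * Real.cot (Real.pi * ε) * q (M + ε)
      + Real.log |2 * Real.sin (Real.pi * ε)| * s (M + ε) + q M / -ε
      - Real.pi / 2 * (Real.log |ε| / Real.sinh (Real.pi * M) ^ 2)
    - (regularPart p (M - ε) + Real.pi * -Real.cot (Real.pi * ε) * q (M - ε)
      + Real.log |2 * Real.sin (Real.pi * ε)| * s (M - ε) + q M / ε
      - Real.pi / 2 * (Real.log |ε| / Real.sinh (Real.pi * M) ^ 2))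
  field_simp
  ring

theorem rhs_sub_psi_eq_succ (p : ℕ) :
    rhs ((p : ℝ) + 1 / 2) - psi ((p : ℝ) + 1 / 2 + 1)
      = rhs (((p + 1 : ℕ) : ℝ) + 1 / 2) - psi (((p + 1 : ℕ) : ℝ) + 1 / 2 + 1) := by
  have hid : Tendsto (fun ε : ℝ => ε) (𝓝[>] 0) (𝓝 0) := tendsto_id.mono_left nhdsWithin_le_nhds
  have hp : (0 : ℝ) < (p : ℝ) + 1 := by positivity
  have c := (hasDerivAt_psi_add_one hp).continuousAt
  have h1 : Tendsto (fun ε : ℝ => (p : ℝ) + 1 + ε) (𝓝[>] 0) (𝓝 ((p : ℝ) + 1)) := by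
    simpa using hid.const_add ((p : ℝ) + 1)
  have h2 : Tendsto (fun ε : ℝ => (p : ℝ) + 1 - ε) (𝓝[>] 0) (𝓝 ((p : ℝ) + 1)) := by
    simpa using hid.const_sub ((p : ℝ) + 1)
  have h3 := (tendsto_rhs_add_sub_rhs_sub p).sub ((c.tendsto.comp h1).sub (c.tendsto.comp h2))
  simp only [Function.comp_def, sub_self] at h3
  have h4 : Tendsto (fun _ : ℝ =>
      (rhs (((p + 1 : ℕ) : ℝ) + 1 / 2) - psi (((p + 1 : ℕ) : ℝ) + 1 / 2 + 1))
        - (rhs ((p : ℝ) + 1 / 2) - psi ((p : ℝ) + 1 / 2 + 1))) (𝓝[>] (0 : ℝ)) (𝓝 0) := by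
    refine h3.congr' ?_
    filter_upwards [Ioo_mem_nhdsGT (zero_lt_one (α := ℝ))] with ε hε
    obtain ⟨hε0, hε1⟩ := hε
    have e1 := rhs_sub_psi_const (m := p + 1) (x := (p : ℝ) + 1 + ε)
      (y := ((p + 1 : ℕ) : ℝ) + 1 / 2) ⟨by push_cast; linarith, by push_cast; linarith⟩
      ⟨by linarith, by linarith⟩
    have e2 := rhs_sub_psi_const (m := p) (x := (p : ℝ) + 1 - ε) (y := (p : ℝ) + 1 / 2)
      ⟨by linarith, by linarith⟩ ⟨by linarith, by linarith⟩
    linarith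
  have h5 := tendsto_nhds_unique h4 tendsto_const_nhds
  linarith

/-! ### Asymptotics along the half-integers. -/

theorem half_le_abs_sub_half_integer (N k : ℕ) :
    1 / 2 ≤ |((k : ℝ) + 1) - ((N : ℝ) + 1 / 2)| := by
  rcases lt_or_ge k N with h | h
  · have : (k : ℝ) + 1 ≤ N := by exact_mod_cast h
    rw [abs_of_neg (by linarith)]
    linarith
  · have : (N : ℝ) ≤ k := by exact_mod_cast h
    rw [abs_of_pos (by linarith)]
    linarith

theorem tendsto_half_integer : Tendsto (fun N : ℕ => (N : ℝ) + 1 / 2) atTop atTop :=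
  tendsto_atTop_add_const_right _ _ tendsto_natCast_atTop_atTop

theorem tendsto_tsum_poleTerm_half_integer :
    Tendsto (fun N : ℕ => ∑' k : ℕ, poleTerm ((N : ℝ) + 1 / 2) (k + 1)) atTop (𝓝 0) := by
  have h0 : Tendsto (fun N : ℕ => 4 / ((N : ℝ) + 1 / 2) * ∑' n : ℕ, 1 / ((n : ℝ) + 1) ^ 2) atTop
      (𝓝 0) := by
    have h := (tendsto_const_nhds (x := (4 : ℝ))).div_atTop tendsto_half_integer
    have h2 := h.mul_const (∑' n : ℕ, 1 / ((n : ℝ) + 1) ^ 2)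
    rwa [zero_mul] at h2
  refine squeeze_zero_norm (fun N => ?_) h0
  refine tsum_of_norm_bounded (f := fun k => poleTerm ((N : ℝ) + 1 / 2) (k + 1))
    (summable_one_div_nat_add_one_sq.hasSum.mul_left (4 / ((N : ℝ) + 1 / 2))) fun k => ?_
  have hg := half_le_abs_sub_half_integer N k
  rw [poleTerm_succ, mul_comm (Real.exp _ - 1), ← div_div]
  have hx : 0 < (N : ℝ) + 1 / 2 := by positivity
  set x := (N : ℝ) + 1 / 2
  set K := (k : ℝ) + 1 with hK
  have hK0 : 0 < K := by positivity
  have hK1 : 1 ≤ K := by rw [hK]; linarith [(k.cast_nonneg : (0 : ℝ) ≤ k)]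
  refine abs_div_le_of_pow_six hK0 ?_ (pow_le_exp_sub_one k)
  have h2 : x / 2 ≤ |K ^ 2 - x ^ 2| := by
    rw [show K ^ 2 - x ^ 2 = (K - x) * (K + x) by ring, abs_mul,
      abs_of_pos (by positivity : 0 < K + x)]
    nlinarith
  rw [abs_div, abs_of_pos (by positivity : 0 < 2 * K)]
  calc 2 * K / |K ^ 2 - x ^ 2| ≤ 2 * K / (x / 2) := by gcongr
    _ = 4 / x * K := by field_simp; norm_num
    _ ≤ 4 / x * K ^ 4 := by
      gcongr
      exact le_self_pow₀ hK1 (by norm_num)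

theorem summable_one_div_sinh_sq_nat :
    Summable fun k : ℕ => 1 / Real.sinh (Real.pi * ((k : ℝ) + 1)) ^ 2 := by
  refine Summable.of_norm_bounded summable_one_div_nat_add_one_sq fun k => ?_
  have hK1 : (1 : ℝ) ≤ (k : ℝ) + 1 := by linarith [(k.cast_nonneg : (0 : ℝ) ≤ k)]
  have h := abs_div_le_of_pow_six (C := 1) (s := 1) (by positivity : (0 : ℝ) < (k : ℝ) + 1)
    (by rw [abs_one, one_mul]; exact one_le_pow₀ hK1) (pow_le_sinh_sq k)
  rwa [one_mul] at h

/-- Write `log |K⁴ - x⁴| = 4 log x + log (|K⁴ - x⁴| / x⁴)`; the last logarithm tends to `0` for each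
fixed `K`, and dominated convergence applies. -/
theorem tendsto_tsum_logTerm_half_integer :
    Tendsto (fun N : ℕ => (∑' k : ℕ, logTerm ((N : ℝ) + 1 / 2) (k + 1))
      - 4 * (∑' k : ℕ, 1 / Real.sinh (Real.pi * ((k : ℝ) + 1)) ^ 2) * Real.log ((N : ℝ) + 1 / 2))
      atTop (𝓝 0) := by
  have key : Tendsto (fun N : ℕ => ∑' k : ℕ,
      Real.log (|((k : ℝ) + 1) ^ 4 - ((N : ℝ) + 1 / 2) ^ 4| / ((N : ℝ) + 1 / 2) ^ 4)
        / Real.sinh (Real.pi * ((k : ℝ) + 1)) ^ 2) atTop (𝓝 (∑' _ : ℕ, (0 : ℝ))) := by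
    refine tendsto_tsum_of_dominated_convergence
      (summable_one_div_nat_add_one_sq.mul_left 5) ?_ ?_
    · intro k
      have h1 : Tendsto (fun N : ℕ => ((k : ℝ) + 1) ^ 4 / ((N : ℝ) + 1 / 2) ^ 4 - 1) atTop
          (𝓝 (0 - 1)) :=
        (tendsto_const_nhds.div_atTop
          ((tendsto_pow_atTop (by norm_num)).comp tendsto_half_integer)).sub_const 1
      have h2 := (Real.continuousAt_log (by norm_num : |(0 : ℝ) - 1| ≠ 0)).tendsto.comp h1.abs
      have h3 := h2.div_const (Real.sinh (Real.pi * ((k : ℝ) + 1)) ^ 2)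
      simp only [zero_sub, abs_neg, abs_one, Real.log_one, zero_div] at h3
      refine h3.congr fun N => ?_
      have hx : 0 < ((N : ℝ) + 1 / 2) ^ 4 := by positivity
      rw [Function.comp_apply, div_sub_one hx.ne', abs_div, abs_of_pos hx]
    · filter_upwards [eventually_ge_atTop 1] with N hN k
      have hg := half_le_abs_sub_half_integer N k
      have hN' : (1 : ℝ) ≤ N := by exact_mod_cast hN
      have hx : 1 ≤ (N : ℝ) + 1 / 2 := by linarith
      set x := (N : ℝ) + 1 / 2
      set K := (k : ℝ) + 1 with hK
      have hK0 : 0 < K := by positivity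
      have hK1 : 1 ≤ K := by rw [hK]; linarith [(k.cast_nonneg : (0 : ℝ) ≤ k)]
      have hK4 : 1 ≤ K ^ 4 := one_le_pow₀ hK1
      have hKK : K ≤ K ^ 4 := le_self_pow₀ hK1 (by norm_num)
      have hx4 : 1 ≤ x ^ 4 := one_le_pow₀ hx
      have hx0 : 0 < x := by linarith
      refine abs_div_le_of_pow_six hK0 ?_ (pow_le_sinh_sq k)
      have hlow : x ^ 4 / (1 + 2 * K) ≤ |K ^ 4 - x ^ 4| := by
        -- As `|K - x| ≥ 1/2`, `x ≤ |K - x| + K ≤ |K - x| (1 + 2K)`. This keeps the majorant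
        -- independent of `N` even when `K` is close to `x`.
        have h1 : x ≤ |K - x| * (1 + 2 * K) := by
          have := neg_le_abs (K - x)
          nlinarith
        rw [show K ^ 4 - x ^ 4 = (K - x) * ((K + x) * (K ^ 2 + x ^ 2)) by ring, abs_mul,
          abs_of_pos (by positivity : 0 < (K + x) * (K ^ 2 + x ^ 2)),
          div_le_iff₀ (by positivity)]
        have h2 : x ^ 3 ≤ (K + x) * (K ^ 2 + x ^ 2) := by
          have : 0 ≤ K ^ 3 + K * x ^ 2 + x * K ^ 2 := by positivity
          nlinarith
        calc x ^ 4 = x * x ^ 3 := by ring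
          _ ≤ |K - x| * (1 + 2 * K) * ((K + x) * (K ^ 2 + x ^ 2)) :=
            mul_le_mul h1 h2 (by positivity) (by positivity)
          _ = _ := by ring
      have hpos : 0 < |K ^ 4 - x ^ 4| := lt_of_lt_of_le (by positivity) hlow
      have hup : |K ^ 4 - x ^ 4| / x ^ 4 ≤ 2 * K ^ 4 := by
        rw [div_le_iff₀ (by positivity), abs_le]
        constructor <;> nlinarith [mul_le_mul_of_nonneg_left hx4 (by linarith : 0 ≤ K ^ 4),
          mul_le_mul_of_nonneg_right hK4 (by linarith : 0 ≤ x ^ 4)]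
      have hinv : 1 / (|K ^ 4 - x ^ 4| / x ^ 4) ≤ 3 * K ^ 4 := by
        rw [one_div_div, div_le_iff₀ hpos]
        have h1 := (div_le_iff₀ (by positivity)).1 hlow
        calc x ^ 4 ≤ |K ^ 4 - x ^ 4| * (1 + 2 * K) := h1
          _ ≤ |K ^ 4 - x ^ 4| * (3 * K ^ 4) := by
            gcongr
            linarith
          _ = _ := by ring
      calc _ ≤ _ := abs_log_le (by positivity)
        _ ≤ 5 * K ^ 4 := by linarith
  rw [tsum_zero] at key
  refine key.congr fun N => ?_
  have hx : (N : ℝ) + 1 / 2 ∈ Ioo (N : ℝ) (N + 1) := ⟨by linarith, by linarith⟩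
  have hx0 := pos_of_mem_Ioo_nat hx
  rw [show 4 * (∑' k : ℕ, 1 / Real.sinh (Real.pi * ((k : ℝ) + 1)) ^ 2)
      * Real.log ((N : ℝ) + 1 / 2) = 4 * Real.log ((N : ℝ) + 1 / 2) *
        ∑' k : ℕ, 1 / Real.sinh (Real.pi * ((k : ℝ) + 1)) ^ 2 by ring, ← tsum_mul_left,
    ← (summable_logTerm hx).tsum_sub (summable_one_div_sinh_sq_nat.mul_left _)]
  refine tsum_congr fun k => ?_
  have hne : ((k : ℝ) + 1) ^ 4 - ((N : ℝ) + 1 / 2) ^ 4 ≠ 0 := by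
    rw [show ((k : ℝ) + 1) ^ 4 - ((N : ℝ) + 1 / 2) ^ 4
      = (((k : ℝ) + 1) ^ 2 - ((N : ℝ) + 1 / 2) ^ 2)
        * (((k : ℝ) + 1) ^ 2 + ((N : ℝ) + 1 / 2) ^ 2) by ring]
    exact mul_ne_zero (sq_sub_sq_ne_zero hx k) (by positivity)
  rw [logTerm_succ, Real.log_div (abs_ne_zero.2 hne) (by positivity), Real.log_pow]
  push_cast
  ring

/-- At half-integers the cotangent vanishes and `|2 sin πx| = 2`, so only multiples of `log x` fail
to tend to zero. -/
theorem tendsto_rhs_sub_psi_sub_log :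
    Tendsto (fun N : ℕ => rhs ((N : ℝ) + 1 / 2) - psi ((N : ℝ) + 1 / 2 + 1)
      - (Real.pi / 3 - 2 * Real.pi * (∑' k : ℕ, 1 / Real.sinh (Real.pi * ((k : ℝ) + 1)) ^ 2) - 1)
        * Real.log ((N : ℝ) + 1 / 2)) atTop (𝓝 0) := by
  have hpi := Real.pi_pos
  have t1 : Tendsto (fun x : ℝ => 1 / (2 * x)) atTop (𝓝 0) :=
    tendsto_const_nhds.div_atTop (tendsto_id.const_mul_atTop two_pos)
  have t2 : Tendsto (fun x : ℝ => 1 / (4 * Real.pi * x ^ 2)) atTop (𝓝 0) :=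
    tendsto_const_nhds.div_atTop
      ((tendsto_pow_atTop two_ne_zero).const_mul_atTop (by positivity))
  have t3 : Tendsto (fun x : ℝ => Real.log 2 / (4 * Real.sinh (Real.pi * x) ^ 2)) atTop (𝓝 0) := by
    have hsinh : Tendsto (fun x : ℝ => Real.sinh (Real.pi * x)) atTop atTop := by
      refine tendsto_atTop_mono' _ ?_ (tendsto_id.const_mul_atTop hpi)
      filter_upwards [eventually_ge_atTop 0] with x hx
      exact Real.self_le_sinh_iff.2 (by simp only [id]; positivity)
    exact tendsto_const_nhds.div_atTop
      (((tendsto_pow_atTop two_ne_zero).comp hsinh).const_mul_atTop four_pos)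
  have hT := tendsto_half_integer
  have tot := (((((t1.comp hT).sub (t2.comp hT)).add tendsto_tsum_poleTerm_half_integer).sub
    (tendsto_tsum_logTerm_half_integer.const_mul (Real.pi / 2))).add
    (((t3.comp hT).sub (tendsto_tsum_doubleTerm_atTop.comp hT)).const_mul (2 * Real.pi))).sub
    (tendsto_psi_add_one_sub_log.comp hT)
  simp only [mul_zero, sub_zero, add_zero] at tot
  refine tot.congr fun N => ?_
  have e : Real.pi * ((N : ℝ) + 1 / 2) = N * Real.pi + Real.pi / 2 := by ring
  have hcot : Real.cot (Real.pi * ((N : ℝ) + 1 / 2)) = 0 := by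
    rw [e, cot_add_nat_mul_pi, Real.cot_eq_cos_div_sin, Real.cos_pi_div_two, zero_div]
  have hsin : |2 * Real.sin (Real.pi * ((N : ℝ) + 1 / 2))| = 2 := by
    rw [abs_mul, e, abs_sin_add_nat_mul_pi, Real.sin_pi_div_two]
    norm_num
  simp only [Function.comp_apply]
  rw [rhs_eq, hcot, hsin]
  ring

theorem rhs_sub_psi_half_integer (N : ℕ) :
    rhs ((N : ℝ) + 1 / 2) - psi ((N : ℝ) + 1 / 2 + 1) = 0 := by
  have hconst : ∀ N : ℕ, rhs ((N : ℝ) + 1 / 2) - psi ((N : ℝ) + 1 / 2 + 1)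
      = rhs (((0 : ℕ) : ℝ) + 1 / 2) - psi (((0 : ℕ) : ℝ) + 1 / 2 + 1) := by
    intro N
    induction N with
    | zero => rfl
    | succ N ih => rw [← rhs_sub_psi_eq_succ, ih]
  have h := tendsto_rhs_sub_psi_sub_log
  simp only [hconst] at h
  rw [hconst]
  set C := rhs (((0 : ℕ) : ℝ) + 1 / 2) - psi (((0 : ℕ) : ℝ) + 1 / 2 + 1)
  set A := Real.pi / 3
    - 2 * Real.pi * (∑' k : ℕ, 1 / Real.sinh (Real.pi * ((k : ℝ) + 1)) ^ 2) - 1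
  have hlog : Tendsto (fun N : ℕ => Real.log ((N : ℝ) + 1 / 2)) atTop atTop :=
    Real.tendsto_log_atTop.comp tendsto_half_integer
  -- A bounded expression `C - A log` forces `A = 0`, which incidentally evaluates `∑ 1 / sinh² πk`
  -- as `1/6 - 1/(2π)`.
  have hA : A = 0 := by
    by_contra hA
    have h2 := (h.const_sub C).const_mul A⁻¹
    refine not_tendsto_nhds_of_tendsto_atTop hlog _ (h2.congr fun N => ?_)
    field_simp
    ring
  simp only [hA, zero_mul, sub_zero] at h
  exact tendsto_nhds_unique tendsto_const_nhds h

/-! ### The identity off the integers and its limit at them. -/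

theorem psi_add_one_eq_rhs {m : ℕ} {x : ℝ} (hx : x ∈ Ioo (m : ℝ) (m + 1)) :
    psi (x + 1) = rhs x := by
  have h := rhs_sub_psi_const hx (y := (m : ℝ) + 1 / 2) ⟨by linarith, by linarith⟩
  rw [rhs_sub_psi_half_integer] at h
  linarith

theorem mem_Ioo_floor {x : ℝ} (hx : 0 < x) (h : ∀ m : ℕ, x ≠ (m : ℝ)) :
    x ∈ Ioo ((⌊x⌋₊ : ℕ) : ℝ) ((⌊x⌋₊ : ℕ) + 1) :=
  ⟨lt_of_le_of_ne (Nat.floor_le hx.le) (h _).symm, Nat.lt_floor_add_one x⟩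

/-- On a punctured neighbourhood of `m` the two sides already agree, so continuity of `psi` gives
the limit. -/
theorem tendsto_rhs_nat {m : ℕ} (hm : 1 ≤ m) :
    Tendsto rhs (𝓝[{(m : ℝ)}ᶜ] (m : ℝ)) (𝓝 (psi ((m : ℝ) + 1))) := by
  have hm0 : (1 : ℝ) ≤ m := by exact_mod_cast hm
  have c := (hasDerivAt_psi_add_one (by linarith : (0 : ℝ) < m)).continuousAt
  refine (c.tendsto.mono_left nhdsWithin_le_nhds).congr' ?_
  have hn : Ioo ((m : ℝ) - 1) (m + 1) ∈ 𝓝 (m : ℝ) := Ioo_mem_nhds (by linarith) (by linarith)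
  filter_upwards [self_mem_nhdsWithin, mem_nhdsWithin_of_mem_nhds hn] with x hx1 hx2
  refine psi_add_one_eq_rhs (mem_Ioo_floor (by linarith [hx2.1]) fun k hk => hx1 ?_)
  rw [hk] at hx2
  have h1 : m < k + 1 := by
    have := hx2.1
    have : (m : ℝ) < k + 1 := by linarith
    exact_mod_cast this
  have h2 : k < m + 1 := by exact_mod_cast hx2.2
  rw [mem_singleton_iff, hk, show k = m by omega]

end RamanujanPsi

theorem mainTheorem1 :
    (∀ x : ℝ, 0 < x → (∀ m : ℕ, x ≠ (m : ℝ)) →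
      Summable (fun k : ℕ => RamanujanPsi.poleTerm x (k + 1)) ∧
      Summable (fun k : ℕ => RamanujanPsi.logTerm x (k + 1)) ∧
      (∀ k : ℕ, Summable (fun n : ℕ => RamanujanPsi.sinTerm x (k + 1) (n + 1))) ∧
      (∀ k : ℕ, Summable (fun n : ℕ => RamanujanPsi.cosTerm x (k + 1) (n + 1))) ∧
      Summable (fun k : ℕ => RamanujanPsi.doubleTerm x (k + 1)) ∧
      RamanujanPsi.psi (x + 1) = RamanujanPsi.rhs x) ∧
    (∀ m : ℕ, 1 ≤ m →
      Filter.Tendsto RamanujanPsi.rhs (nhdsWithin (m : ℝ) {(m : ℝ)}ᶜ)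
        (nhds (RamanujanPsi.psi ((m : ℝ) + 1)))) := by
  refine ⟨fun x hx hne => ?_, fun m hm => RamanujanPsi.tendsto_rhs_nat hm⟩
  have h := RamanujanPsi.mem_Ioo_floor hx hne
  exact ⟨RamanujanPsi.summable_poleTerm h, RamanujanPsi.summable_logTerm h,
    fun k => RamanujanPsi.summable_sinTerm x (k + 1),
    fun k => RamanujanPsi.summable_cosTerm x (k + 1),
    RamanujanPsi.summable_doubleTerm hx, RamanujanPsi.psi_add_one_eq_rhs h⟩
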